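/- Let $\mathcal A$ and $\mathcal B$ be finite nonempty alphabets and let $(m_n)_{n\ge1}$ be integers with $m_n\ge2$. Put $\mathcal A_0=\mathcal A$ and $\mathcal A_n=(\mathcal A_{n-1})^{m_n}$ for $n\ge 1$. Let $\varrho_0\colon\mathcal A\to\mathcal B^\ast$ take values in the nonempty words, let $\mathbf t_n\colon\mathcal A_n\to\mathcal B^\ast$ ($n\ge1$) be arbitrary maps, and define inductively, by concatenation of words, $$\varrho_n(a)=\varrho_{n-1}(a_1)\cdots\varrho_{n-1}(a_{m_n})\,\mathbf t_n(a),\qquad a=(a_1,\dots,a_{m_n})\in\mathcal A_n .$$ Write $|w|$ for the length of a word $w$. Assume that $|\varrho_0(a)|$ is the same for all $a\in\mathcal A$, and that there is $K>0$ with $|\mathbf t_n(a)|\le K2^{-n}\sum_{i=1}^{m_n}|\varrho_{n-1}(a_i)|$ for all $n\ge1$ and $a\in\mathcal A_n$. For a Bernoulli measure $\mathfrak p$ on $\mathcal A^{\mathbb Z}$ (given by any probability vector on $\mathcal A$), let $\mathfrak p_n$ be its image on $(\mathcal A_n)^{\mathbb Z}$ under the map that cuts a sequence into consecutive blocks of length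 $m_1\cdots m_n$, one of them starting at position $0$, and reads each block as a letter of $\mathcal A_n$. Let $\widetilde{\mathfrak p}_n$ be the Bernoulli measure on $(\mathcal A_n)^{\mathbb Z}$ with $$\widetilde{\mathfrak p}_n([a])=\frac{|\varrho_n(a)|\,\mathfrak p_n([a])}{\sum_{b\in\mathcal A_n}|\varrho_n(b)|\,\mathfrak p_n([b])},\qquad a\in\mathcal A_n,$$ where $[a]$ is the set of sequences whose entry at position $0$ is $a$. Define the measure on $\mathcal B^{\mathbb Z}$ $$\nu_n(\mathfrak p)=\kappa_{\rm inv}(\mathcal A_n,\varrho_n,\widetilde{\mathfrak p}_n)=\sum_{a\in\mathcal A_n}\frac1{|\varrho_n(a)|}\sum_{j=0}^{|\varrho_n(a)|-1}(\sigma^j\circ\underline\varrho_n)_\ast\big(\widetilde{\mathfrak p}_n|_{[a]}\big),$$ where $\sigma$ is the left shift on $\mathcal B^{\mathbb Z}$ and $\underline\varrho_n(\dots,x_{-1}\,|\,x_0,x_1,\dots)=(\dots\varrho_n(x_{-1})\,|\,\varrho_n(x_0)\varrho_n(x_1)\dots)$, the bar preceding position $0$. For words $v,w\in\mathcal B^N$,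 $N\ge1$, let $\bar f_N(v,w)=1-k/N$, where $k$ is the largest length of a common (not necessarily contiguous) substring of $v$ and $w$. For probability measures $\nu,\nu'$ on $\mathcal B^{\mathbb Z}$ let $\bar f_N(\nu,\nu')$ be the infimum of $\int\bar f_N\,d\gamma$ over all measures $\gamma$ on $\mathcal B^N\times\mathcal B^N$ whose marginals are the distributions of $(x_0,\dots,x_{N-1})$ under $\nu$ and $\nu'$, and let $\bar f(\nu,\nu')=\inf\{\varepsilon:\bar f_N(\nu,\nu')\le\varepsilon\text{ for infinitely many }N\}$. Then all $\nu_n(\mathfrak p)$ are probability measures, and the sequences $(\nu_n(\mathfrak p))_n$ are $\bar f$-Cauchy uniformly in $\mathfrak p$: for every $\varepsilon>0$ there is $n_0\ge1$ such that for all $k,\ell\ge n_0$ and all Bernoulli measures $\mathfrak p$ on $\mathcal A^{\mathbb Z}$, $$\bar f\big(\nu_k(\mathfrak p),\nu_\ell(\mathfrak p)\big)<\varepsilon .$$ -/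

import Mathlib

open MeasureTheory Filter
open scoped ENNReal

namespace BernoulliCoded

noncomputable section

universe u v

/-! ### The edit distance on words and the `f̄`-distance between measures -/

section FBar

variable {B : Type v}

/-- `a` and `b` have a common substring (not necessarily contiguous) of length `k`. -/
def HasCommonSubstring {n : ℕ} (a b : Fin n → B) (k : ℕ) : Prop :=
  ∃ i j : Fin k ↪o Fin n, ∀ s, a (i s) = b (j s)

/-- The length of the longest common substring of two `n`-words. -/
def maxCommon {n : ℕ} (a b : Fin n → B) : ℕ :=
  sSup {k : ℕ | HasCommonSubstring a b k}

/-- The edit distance of two `n`-words: `1 - k / n`, with `k` the length of their longest common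
substring (only used for `n ≥ 1`). -/
def editDist {n : ℕ} (a b : Fin n → B) : ℝ :=
  1 - (maxCommon a b : ℝ) / (n : ℝ)

/-- The `n`-word read by a bi-infinite sequence at the positions `0, …, n - 1`. -/
def firstWord (n : ℕ) (x : ℤ → B) : Fin n → B := fun i => x (i : ℤ)

variable [MeasurableSpace B]

/-- The distribution of the `n`-cylinders under a measure on `B^ℤ`. -/
def wordLaw (n : ℕ) (ν : Measure (ℤ → B)) : Measure (Fin n → B) :=
  ν.map (firstWord n)

/-- The `n`-joinings of `ν` and `ν'`. -/
def joinings (n : ℕ) (ν ν' : Measure (ℤ → B)) : Set (Measure ((Fin n → B) × (Fin n → B))) :=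
  {γ | γ.map Prod.fst = wordLaw n ν ∧ γ.map Prod.snd = wordLaw n ν'}

/-- `f̄_n(ν, ν')`: infimum over `n`-joinings of the expected edit distance. -/
def fbarN (n : ℕ) (ν ν' : Measure (ℤ → B)) : ℝ :=
  sInf ((fun γ : Measure ((Fin n → B) × (Fin n → B)) => ∫ w, editDist w.1 w.2 ∂γ) ''
    joinings n ν ν')

/-- The `f̄`-distance of two probability measures on `B^ℤ`. -/
def fbar (ν ν' : Measure (ℤ → B)) : ℝ :=
  sInf {ε : ℝ | ∃ᶠ n in atTop, fbarN n ν ν' ≤ ε}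

end FBar

/-! ### Bernoulli measures -/

section Bernoulli

variable {A : Type u}

/-- The cylinder `[a]` of the letter `a`. -/
def letterCylinder (a : A) : Set (ℤ → A) := {x | x 0 = a}

variable [Fintype A] [MeasurableSpace A]

/-- The measure on `A` with weights `p`. -/
def letterLaw (p : A → ℝ) : Measure A :=
  ∑ a, ENNReal.ofReal (p a) • Measure.dirac a

/-- The Bernoulli measure on `A^ℤ` given by the probability vector `p`. -/
def bernoulli (p : A → ℝ) : Measure (ℤ → A) :=
  Measure.infinitePi fun _ : ℤ => letterLaw p

variable (A) in
/-- The space of all Bernoulli measures on `A^ℤ`. -/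
def bernoulliMeasures : Set (Measure (ℤ → A)) :=
  bernoulli '' stdSimplex ℝ A

end Bernoulli

/-! ### Substitutions and Bernoulli-coded measures -/

section Substitution

variable {A : Type u} {B : Type v}

/-- The left shift. -/
def shift (x : ℤ → B) : ℤ → B := fun k => x (k + 1)

/-- The extension of a substitution `ϱ` with nonempty words to bi-infinite sequences,
`(… ϱ(x₋₁) | ϱ(x₀) ϱ(x₁) …)`.  The entry at position `i ≥ 0` is entry number `i` of the word
`ϱ(x₀) ⋯ ϱ(x_i)`, the entry at position `-(i + 1)` is entry number `i`, counted from the right,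
of `ϱ(x_{-(i+1)}) ⋯ ϱ(x₋₁)`; the default value is never used, as all words are nonempty. -/
def extend [Nonempty B] (ϱ : A → List B) (x : ℤ → A) : ℤ → B
  | Int.ofNat i =>
      ((List.range (i + 1)).flatMap fun n : ℕ => ϱ (x (n : ℤ))).getD i (Classical.arbitrary B)
  | Int.negSucc i =>
      ((List.range (i + 1)).flatMap fun n : ℕ => (ϱ (x (Int.negSucc n))).reverse).getD i
        (Classical.arbitrary B)

variable [Fintype A] [MeasurableSpace A] [MeasurableSpace B]

/-- The measure `κ_inv(A, ϱ, P)` on `B^ℤ`, that is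
`∑ a, 1/|ϱ(a)| ∑_{j < |ϱ(a)|} (σ^j ∘ ϱ)_* (P|_[a])`. -/
def kappaInv [Nonempty B] (ϱ : A → List B) (P : Measure (ℤ → A)) : Measure (ℤ → B) :=
  ∑ a, ((ϱ a).length : ℝ≥0∞)⁻¹ •
    ∑ j ∈ Finset.range (ϱ a).length,
      (P.restrict (letterCylinder a)).map (shift^[j] ∘ extend ϱ)

/-- The length-weighted probability vector
`a ↦ |ϱ(a)| P([a]) / ∑_b |ϱ(b)| P([b])`. -/
def tildeVec (ϱ : A → List B) (P : Measure (ℤ → A)) (a : A) : ℝ :=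
  ((ϱ a).length * P.real (letterCylinder a)) /
    ∑ b, ((ϱ b).length * P.real (letterCylinder b))

end Substitution

/-! ### Cascades of repeat-and-tail substitutions -/

section Cascade

variable (A : Type u) (m : ℕ → ℕ)

/-- The alphabets `A₀ = A`, `A_n = (A_{n-1})^{m_n}` (the value `m 0` is not used). -/
def Level : ℕ → Type u
  | 0 => A
  | n + 1 => Fin (m (n + 1)) → Level n

instance instFintypeLevel [Fintype A] : (n : ℕ) → Fintype (Level A m n)
  | 0 => inferInstanceAs (Fintype A)
  | n + 1 =>
      haveI := instFintypeLevel n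
      inferInstanceAs (Fintype (Fin (m (n + 1)) → Level A m n))

instance instMeasurableSpaceLevel [MeasurableSpace A] : (n : ℕ) → MeasurableSpace (Level A m n)
  | 0 => inferInstanceAs (MeasurableSpace A)
  | n + 1 =>
      haveI := instMeasurableSpaceLevel n
      inferInstanceAs (MeasurableSpace (Fin (m (n + 1)) → Level A m n))

variable {A}

/-- Cutting a bi-infinite sequence into consecutive blocks of length `r`, one of them starting at
position `0`.  For `r ≥ 1` this is the inverse of
`(… | (a₀¹ … a₀ʳ), (a₁¹ … a₁ʳ), …) ↦ (… | a₀¹ … a₀ʳ a₁¹ … a₁ʳ …)`. -/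
def blocks {C : Type u} (r : ℕ) (x : ℤ → C) : ℤ → Fin r → C :=
  fun i j => x (i * (r : ℤ) + (j : ℤ))

/-- The bijection `A^ℤ → (A_n)^ℤ`, inverse of the respelling map `(A_n)^ℤ → A^ℤ`. -/
def toLevel : (n : ℕ) → (ℤ → A) → (ℤ → Level A m n)
  | 0 => fun x => x
  | n + 1 => fun x => blocks (m (n + 1)) (toLevel n x)

variable {B : Type v}

/-- The repeat-and-tail substitutions
`ϱ_n(a₁ … a_{m_n}) = ϱ_{n-1}(a₁) ⋯ ϱ_{n-1}(a_{m_n}) t_n(a₁ … a_{m_n})`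
(the value `t 0` is not used). -/
def cascade (ϱ₀ : A → List B) (t : (n : ℕ) → Level A m n → List B) :
    (n : ℕ) → Level A m n → List B
  | 0 => ϱ₀
  | n + 1 => fun a =>
      (List.ofFn fun i : Fin (m (n + 1)) => cascade ϱ₀ t n (a i)).flatten ++ t (n + 1) a

/-- Control of tail lengths: all words `ϱ₀(a)` have the same length, and for some `K > 0`,
`|t_n(a)| ≤ K 2⁻ⁿ ∑ᵢ |ϱ_{n-1}(aᵢ)|` for all `n ≥ 1` and `a = (a₁ … a_{m_n}) ∈ A_n`. -/
def TailControl (ϱ₀ : A → List B) (t : (n : ℕ) → Level A m n → List B) : Prop :=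
  (∀ a b, (ϱ₀ a).length = (ϱ₀ b).length) ∧
  ∃ K : ℝ, 0 < K ∧ ∀ (n : ℕ) (a : Level A m (n + 1)),
    ((t (n + 1) a).length : ℝ) ≤
      K * (2 : ℝ)⁻¹ ^ (n + 1) *
        ∑ i : Fin (m (n + 1)), ((cascade m ϱ₀ t n (a i)).length : ℝ)

variable [Fintype A] [MeasurableSpace A] [MeasurableSpace B]

/-- `P_n`, the measure on `(A_n)^ℤ` corresponding to `P` on `A^ℤ`. -/
def levelMeasure (P : Measure (ℤ → A)) (n : ℕ) : Measure (ℤ → Level A m n) :=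
  P.map (toLevel m n)

/-- `ν_n(P) = κ_inv(A_n, ϱ_n, P̃_n)`, where `P̃_n` is the Bernoulli measure on `(A_n)^ℤ` of the
length-weighted vector of `P_n`. -/
def nu [Nonempty B] (ϱ₀ : A → List B) (t : (n : ℕ) → Level A m n → List B) (n : ℕ)
    (P : Measure (ℤ → A)) : Measure (ℤ → B) :=
  kappaInv (cascade m ϱ₀ t n)
    (bernoulli (tildeVec (cascade m ϱ₀ t n) (levelMeasure m P n)))

end Cascade

end

end BernoulliCoded

namespace BernoulliCoded

/-! ### Common sublists and the edit distance -/

section Edit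

variable {B : Type*}

/-! Each `ν_n(𝔭)` is compared with the unweighted and unshifted image of `𝔭` under `ϱ_n`, and these
images are compared with each other on a single random sequence.

Images on two levels (`TailBound.close_map_extend`): for a fixed sequence over `A`, the word spelled
at level `k` arises from the one at level `k + d` by deleting tails. By tail control the two lengths
differ by a factor of at most `∏_{i>k} (1 + K 2⁻ⁱ) ≤ exp (K 2⁻ᵏ)`, so the two words are close in
edit distance, whatever the sequence.

`ν_n` and the image (`TailBound.close_nu_map`): the random shift moves the origin by at most one
word, which costs `O(1/N)`. The length-weighting replaces one i.i.d. letter law by another. Coupling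
the two letter by letter costs their `ℓ¹`-distance times the ratio of the longest to the shortest
word, which is at most `exp K` (`close_kappaInv_bernoulli`). The `ℓ¹`-distance is the relative mean
deviation of `|ϱ_n|`, hence at most its relative standard deviation (`sum_abs_tildeVec_sub_le`). A
letter of `A_n` consists of `m_n ≥ 2` independent letters of the preceding level, so the relative
variance contracts up to a summable tail error (`TailBound.variance_length_le`).

The triangle inequality for joinings combines the three estimates. Apart from `O(1/N)` terms, the
bounds depend only on the level and not on `𝔭`, which gives uniformity. -/

theorem exists_common_sublist {b w₁ w₂ : List B} (h₁ : w₁.Sublist b) (h₂ : w₂.Sublist b) :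
    ∃ w : List B, w.Sublist w₁ ∧ w.Sublist w₂ ∧ w₁.length + w₂.length ≤ w.length + b.length := by
  induction h₁ generalizing w₂ with
  | slnil => exact ⟨[], List.nil_sublist _, List.nil_sublist _, by simpa using h₂.length_le⟩
  | @cons w₁ b x h ih =>
    cases h₂ with
    | cons _ h₂ =>
      obtain ⟨w, a1, a2, a3⟩ := ih h₂
      exact ⟨w, a1, a2, by simp only [List.length_cons]; omega⟩
    | @cons_cons w₂ _ _ h₂ =>
      obtain ⟨w, a1, a2, a3⟩ := ih h₂
      exact ⟨w, a1, a2.cons _, by simp only [List.length_cons]; omega⟩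
  | @cons_cons w₁ b x h ih =>
    cases h₂ with
    | cons _ h₂ =>
      obtain ⟨w, a1, a2, a3⟩ := ih h₂
      exact ⟨w, a1.cons _, a2, by simp only [List.length_cons]; omega⟩
    | @cons_cons w₂ _ _ h₂ =>
      obtain ⟨w, a1, a2, a3⟩ := ih h₂
      exact ⟨x :: w, a1.cons_cons _, a2.cons_cons _, by simp only [List.length_cons]; omega⟩

theorem sublist_ofFn_iff {n : ℕ} {a : Fin n → B} {w : List B} :
    w.Sublist (List.ofFn a) ↔ ∃ i : Fin w.length ↪o Fin n, ∀ s, w.get s = a (i s) := by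
  rw [List.sublist_iff_exists_fin_orderEmbedding_get_eq]
  constructor
  · rintro ⟨f, hf⟩
    refine ⟨f.trans (Fin.castOrderIso (List.length_ofFn (f := a))).toOrderEmbedding, fun s => ?_⟩
    rw [hf s]
    simp [Fin.cast]
  · rintro ⟨f, hf⟩
    refine ⟨f.trans (Fin.castOrderIso (List.length_ofFn (f := a)).symm).toOrderEmbedding,
      fun s => ?_⟩
    rw [hf s]
    simp [Fin.cast]

theorem hasCommonSubstring_iff {n : ℕ} {a b : Fin n → B} {k : ℕ} :
    HasCommonSubstring a b k ↔
      ∃ w : List B, w.length = k ∧ w.Sublist (List.ofFn a) ∧ w.Sublist (List.ofFn b) := by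
  constructor
  · rintro ⟨i, j, h⟩
    refine ⟨List.ofFn (fun s => a (i s)), List.length_ofFn, sublist_ofFn_iff.2
      ⟨(Fin.castOrderIso List.length_ofFn).toOrderEmbedding.trans i, fun s => by simp [Fin.cast]⟩,
      sublist_ofFn_iff.2
      ⟨(Fin.castOrderIso List.length_ofFn).toOrderEmbedding.trans j, fun s => ?_⟩⟩
    simp [Fin.cast, h]
  · rintro ⟨w, rfl, h₁, h₂⟩
    obtain ⟨i, hi⟩ := sublist_ofFn_iff.1 h₁
    obtain ⟨j, hj⟩ := sublist_ofFn_iff.1 h₂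
    exact ⟨i, j, fun s => by rw [← hi, ← hj]⟩

theorem HasCommonSubstring.le {n : ℕ} {a b : Fin n → B} {k : ℕ}
    (h : HasCommonSubstring a b k) : k ≤ n := by
  obtain ⟨i, -, -⟩ := h
  simpa using Fintype.card_le_of_injective i i.injective

theorem bddAbove_hasCommonSubstring {n : ℕ} (a b : Fin n → B) :
    BddAbove {k | HasCommonSubstring a b k} := ⟨n, fun _ h => HasCommonSubstring.le h⟩

theorem hasCommonSubstring_maxCommon {n : ℕ} (a b : Fin n → B) :
    HasCommonSubstring a b (maxCommon a b) :=
  Nat.sSup_mem (s := {k | HasCommonSubstring a b k})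
    ⟨0, hasCommonSubstring_iff.2 ⟨[], rfl, List.nil_sublist _, List.nil_sublist _⟩⟩
    (bddAbove_hasCommonSubstring a b)

theorem length_le_maxCommon {n : ℕ} {a b : Fin n → B} {w : List B}
    (h₁ : w.Sublist (List.ofFn a)) (h₂ : w.Sublist (List.ofFn b)) :
    w.length ≤ maxCommon a b :=
  le_csSup (bddAbove_hasCommonSubstring a b) (hasCommonSubstring_iff.2 ⟨w, rfl, h₁, h₂⟩)

theorem editDist_nonneg {n : ℕ} (a b : Fin n → B) : 0 ≤ editDist a b := by
  have h : (maxCommon a b : ℝ) ≤ n := by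
    exact_mod_cast (hasCommonSubstring_maxCommon a b).le
  unfold editDist
  have := div_le_one_of_le₀ h (Nat.cast_nonneg n)
  linarith

theorem editDist_comm {n : ℕ} (a b : Fin n → B) : editDist a b = editDist b a := by
  have : ∀ k, HasCommonSubstring a b k ↔ HasCommonSubstring b a k := fun k =>
    ⟨fun ⟨i, j, h⟩ => ⟨j, i, fun s => (h s).symm⟩, fun ⟨i, j, h⟩ => ⟨j, i, fun s => (h s).symm⟩⟩
  simp only [editDist, maxCommon, this]

/-- Two sets of positions of `b`, of sizes `k₁` and `k₂`, share at least `k₁ + k₂ - n` positions.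
The letters of `b` there form a common sublist of `a` and `c`. -/
theorem editDist_triangle {n : ℕ} (a b c : Fin n → B) :
    editDist a c ≤ editDist a b + editDist b c := by
  obtain ⟨w₁, l₁, h₁, h₁'⟩ := hasCommonSubstring_iff.1 (hasCommonSubstring_maxCommon a b)
  obtain ⟨w₂, l₂, h₂, h₂'⟩ := hasCommonSubstring_iff.1 (hasCommonSubstring_maxCommon b c)
  obtain ⟨w, e₁, e₂, e₃⟩ := exists_common_sublist h₁' h₂
  have h := length_le_maxCommon (e₁.trans h₁) (e₂.trans h₂')
  rw [l₁, l₂, List.length_ofFn] at e₃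
  have h' : (maxCommon a b : ℝ) + maxCommon b c ≤ maxCommon a c + n := by
    exact_mod_cast e₃.trans (by omega)
  unfold editDist
  rcases Nat.eq_zero_or_pos n with rfl | hn
  · simp
  have hn : (0 : ℝ) < n := by exact_mod_cast hn
  have : (maxCommon a b : ℝ) / n + maxCommon b c / n ≤ maxCommon a c / n + 1 := by
    rw [← add_div, ← div_self hn.ne', ← add_div]
    gcongr
  linarith

/-- Two lists with a long common sublist have initial segments of small edit distance. -/
theorem editDist_le_of_sublist {n r : ℕ} (hn : 0 < n) {a b : Fin n → B} {u v w : List B}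
    (ha : List.ofFn a = u.take n) (hb : List.ofFn b = v.take n)
    (hu : w.Sublist u) (hv : w.Sublist v)
    (hur : u.length ≤ w.length + r) (hvr : v.length ≤ w.length + r) :
    editDist a b ≤ r / n := by
  -- The part of `w` embedded beyond position `n` of `u` has length at most `|u| - n`, so at least
  -- `n - r` initial letters of `w` fall in the first `n`. The same initial segment of `w` serves
  -- for `v`.
  have key : ∀ (a : Fin n → B) (u : List B), List.ofFn a = u.take n → w.Sublist u →
      u.length ≤ w.length + r → (w.take (n - r)).Sublist (List.ofFn a) := by
    intro a u ha hu hur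
    have hl : n ≤ u.length := by
      have := congrArg List.length ha
      rw [List.length_ofFn, List.length_take] at this
      omega
    rw [← List.take_append_drop n u, List.sublist_append_iff] at hu
    obtain ⟨w₁, w₂, rfl, h₁, h₂⟩ := hu
    have h₂' := h₂.length_le
    rw [List.length_drop] at h₂'
    rw [List.length_append] at hur
    rw [ha]
    refine List.Sublist.trans ?_ h₁
    rw [List.take_append_of_le_length (by omega)]
    exact List.take_sublist _ _
  have h := length_le_maxCommon (key a u ha hu hur) (key b v hb hv hvr)
  have hl : n ≤ u.length := by
    have := congrArg List.length ha
    rw [List.length_ofFn, List.length_take] at this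
    omega
  rw [List.length_take] at h
  have h' : (n : ℝ) ≤ maxCommon a b + r := by
    exact_mod_cast (by omega : n ≤ maxCommon a b + r)
  unfold editDist
  have hn : (0 : ℝ) < n := by exact_mod_cast hn
  rw [sub_le_iff_le_add, ← add_div, le_div_iff₀ hn]
  linarith

end Edit

/-! ### Joinings with small expected edit distance -/

section Close

variable {B : Type*} [MeasurableSpace B]

/-- There is an `n`-joining of `ν` and `ν'` with expected edit distance at most `δ`. -/
def Close (n : ℕ) (δ : ℝ≥0∞) (ν ν' : Measure (ℤ → B)) : Prop :=
  ∃ γ ∈ joinings n ν ν', ∫⁻ w, ENNReal.ofReal (editDist w.1 w.2) ∂γ ≤ δ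

theorem measurable_firstWord (n : ℕ) : Measurable (firstWord n : (ℤ → B) → Fin n → B) :=
  measurable_pi_lambda _ fun _ => measurable_pi_apply _

theorem isProbabilityMeasure_of_mem_joinings {n : ℕ} {ν ν' : Measure (ℤ → B)}
    [IsProbabilityMeasure ν] {γ : Measure ((Fin n → B) × (Fin n → B))}
    (h : γ ∈ joinings n ν ν') : IsProbabilityMeasure γ := by
  constructor
  have h1 := congrArg (fun μ => μ Set.univ) h.1
  simp only [wordLaw] at h1
  rw [Measure.map_apply measurable_fst MeasurableSet.univ,
    Measure.map_apply (measurable_firstWord n) MeasurableSet.univ] at h1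
  simpa using h1

theorem fbarN_nonneg (n : ℕ) (ν ν' : Measure (ℤ → B)) : 0 ≤ fbarN n ν ν' := by
  apply Real.sInf_nonneg
  rintro _ ⟨γ, -, rfl⟩
  exact integral_nonneg fun w => editDist_nonneg _ _

theorem fbar_le_of_frequently {ν ν' : Measure (ℤ → B)} {ε : ℝ}
    (h : ∃ᶠ n in atTop, fbarN n ν ν' ≤ ε) : fbar ν ν' ≤ ε := by
  refine csInf_le ⟨0, ?_⟩ h
  intro e he
  obtain ⟨n, hn⟩ := he.exists
  exact (fbarN_nonneg n ν ν').trans hn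

variable [Finite B] [DiscreteMeasurableSpace B]

theorem Close.fbarN_le {n : ℕ} {δ : ℝ} (hδ : 0 ≤ δ) {ν ν' : Measure (ℤ → B)}
    (h : Close n (ENNReal.ofReal δ) ν ν') : fbarN n ν ν' ≤ δ := by
  obtain ⟨γ, hγ, hδγ⟩ := h
  unfold fbarN
  refine (csInf_le ⟨0, ?_⟩ (Set.mem_image_of_mem _ hγ)).trans ?_
  · rintro _ ⟨γ, -, rfl⟩
    exact integral_nonneg fun w => editDist_nonneg _ _
  · rw [integral_eq_lintegral_of_nonneg_ae (Eventually.of_forall fun w => editDist_nonneg _ _)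
      (Measurable.of_discrete).aestronglyMeasurable]
    exact ENNReal.toReal_le_of_le_ofReal hδ hδγ

theorem Close.symm {n : ℕ} {δ : ℝ≥0∞} {ν ν' : Measure (ℤ → B)} (h : Close n δ ν ν') :
    Close n δ ν' ν := by
  obtain ⟨γ, hγ, hδ⟩ := h
  refine ⟨γ.map Prod.swap, ⟨?_, ?_⟩, ?_⟩
  · rw [Measure.map_map measurable_fst measurable_swap]
    exact hγ.2
  · rw [Measure.map_map measurable_snd measurable_swap]
    exact hγ.1
  · rw [lintegral_map Measurable.of_discrete measurable_swap]
    refine le_trans (le_of_eq ?_) hδ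
    congr 1
    ext w
    simp only [Prod.fst_swap, Prod.snd_swap, editDist_comm w.2 w.1]

/-- Gluing of two couplings along a common marginal. -/
theorem exists_gluing {X Y Z : Type*} [MeasurableSpace X] [MeasurableSpace Y] [MeasurableSpace Z]
    [StandardBorelSpace Z] [Nonempty Z] (γ₁ : Measure (X × Y)) (γ₂ : Measure (Y × Z))
    [IsFiniteMeasure γ₁] [IsFiniteMeasure γ₂]
    (h : γ₁.map Prod.snd = γ₂.map Prod.fst) :
    ∃ γ : Measure ((X × Y) × Z), γ.map Prod.fst = γ₁ ∧ γ.map (fun w => (w.1.2, w.2)) = γ₂ := by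
  -- Given `(x, y)`, the third coordinate is drawn from the conditional law of `γ₂` given `y`; thus
  -- `x` and `z` are conditionally independent.
  let κ : ProbabilityTheory.Kernel (X × Y) Z := γ₂.condKernel.comap Prod.snd measurable_snd
  refine ⟨γ₁.compProd κ, Measure.fst_compProd _ _, ?_⟩
  have h₂ : γ₂ = (γ₁.map Prod.snd).compProd γ₂.condKernel := by
    rw [h]
    exact (γ₂.disintegrate γ₂.condKernel).symm
  conv_rhs => rw [h₂]
  have hm : Measurable fun w : (X × Y) × Z => (w.1.2, w.2) := by fun_prop
  ext s hs
  rw [Measure.map_apply hm hs, Measure.compProd_apply (hm hs),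
    Measure.compProd_apply hs, lintegral_map (ProbabilityTheory.Kernel.measurable_kernel_prodMk_left hs)
      measurable_snd]
  rfl

theorem Close.trans [Nonempty B] {n : ℕ} {δ₁ δ₂ : ℝ≥0∞} {ν₁ ν₂ ν₃ : Measure (ℤ → B)}
    [IsProbabilityMeasure ν₁] [IsProbabilityMeasure ν₂] (h₁ : Close n δ₁ ν₁ ν₂)
    (h₂ : Close n δ₂ ν₂ ν₃) : Close n (δ₁ + δ₂) ν₁ ν₃ := by
  obtain ⟨γ₁, hγ₁, hδ₁⟩ := h₁
  obtain ⟨γ₂, hγ₂, hδ₂⟩ := h₂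
  have := isProbabilityMeasure_of_mem_joinings hγ₁
  have := isProbabilityMeasure_of_mem_joinings hγ₂
  obtain ⟨γ, e₁, e₂⟩ := exists_gluing γ₁ γ₂ (hγ₁.2.trans hγ₂.1.symm)
  refine ⟨γ.map (fun w => (w.1.1, w.2)), ⟨?_, ?_⟩, ?_⟩
  · rw [← hγ₁.1, ← e₁, Measure.map_map measurable_fst Measurable.of_discrete,
      Measure.map_map measurable_fst Measurable.of_discrete]
    rfl
  · rw [← hγ₂.2, ← e₂, Measure.map_map measurable_snd Measurable.of_discrete,
      Measure.map_map measurable_snd Measurable.of_discrete]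
    rfl
  · rw [lintegral_map Measurable.of_discrete Measurable.of_discrete]
    rw [← e₁, lintegral_map Measurable.of_discrete Measurable.of_discrete] at hδ₁
    rw [← e₂, lintegral_map Measurable.of_discrete Measurable.of_discrete] at hδ₂
    refine le_trans ?_ (add_le_add hδ₁ hδ₂)
    rw [← lintegral_add_left Measurable.of_discrete]
    refine lintegral_mono fun w => ?_
    rw [← ENNReal.ofReal_add (editDist_nonneg _ _) (editDist_nonneg _ _)]
    exact ENNReal.ofReal_le_ofReal (editDist_triangle _ _ _)

end Close

/-! ### Words spelled by a substitution -/

section Spell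

variable {A B : Type*}

/-- The word `ϱ(x₀) ⋯ ϱ(x_{T-1})`. -/
def spell (ϱ : A → List B) (x : ℤ → A) (T : ℕ) : List B :=
  (List.range T).flatMap fun i : ℕ => ϱ (x i)

theorem spell_succ (ϱ : A → List B) (x : ℤ → A) (T : ℕ) :
    spell ϱ x (T + 1) = spell ϱ x T ++ ϱ (x T) := by
  simp [spell, List.range_succ]

theorem spell_prefix (ϱ : A → List B) (x : ℤ → A) {S T : ℕ} (h : S ≤ T) :
    spell ϱ x S <+: spell ϱ x T := by
  induction T, h using Nat.le_induction with
  | base => exact List.prefix_rfl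
  | succ T _ ih =>
    rw [spell_succ]
    exact ih.trans (List.prefix_append _ _)

theorem length_spell (ϱ : A → List B) (x : ℤ → A) (T : ℕ) :
    (spell ϱ x T).length = ∑ i ∈ Finset.range T, (ϱ (x i)).length := by
  induction T with
  | zero => rfl
  | succ T ih => rw [spell_succ, List.length_append, ih, Finset.sum_range_succ]

theorem mul_le_length_spell {ϱ : A → List B} {c : ℕ} (h : ∀ a, c ≤ (ϱ a).length) (x : ℤ → A)
    (T : ℕ) : T * c ≤ (spell ϱ x T).length := by
  rw [length_spell]
  simpa using Finset.card_nsmul_le_sum (Finset.range T) (fun i : ℕ => (ϱ (x i)).length) c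
    fun i _ => h _

theorem shift_iterate_apply (x : ℤ → B) (j : ℕ) (k : ℤ) : shift^[j] x k = x (k + j) := by
  induction j generalizing x with
  | zero => simp
  | succ j ih =>
    rw [Function.iterate_succ_apply, ih, shift]
    push_cast
    ring_nf

/-- Entry `i` of `extend` is read from a spelling of `i + 1` words. These are nonempty, so the entry
exists there, and spellings of different lengths are prefixes of one another. -/
theorem ofFn_firstWord_shift_extend [Nonempty B] {ϱ : A → List B} (hϱ : ∀ a, ϱ a ≠ [])
    (x : ℤ → A) {N j T : ℕ} (hT : N + j ≤ (spell ϱ x T).length) :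
    List.ofFn (firstWord N (shift^[j] (extend ϱ x))) = ((spell ϱ x T).drop j).take N := by
  have key : ∀ i : ℕ, i < (spell ϱ x T).length →
      (spell ϱ x T)[i]? = some (extend ϱ x (i : ℤ)) := by
    intro i hi
    have hi' : i < (spell ϱ x (i + 1)).length := by
      have := mul_le_length_spell (ϱ := ϱ) (c := 1)
        (fun a => List.length_pos_iff.2 (hϱ a)) x (i + 1)
      omega
    have h1 : (spell ϱ x T)[i]? = (spell ϱ x (i + 1))[i]? := by
      rcases le_total T (i + 1) with h | h
      · obtain ⟨s, hs⟩ := spell_prefix ϱ x h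
        rw [← hs, List.getElem?_append_left hi]
      · obtain ⟨s, hs⟩ := spell_prefix ϱ x h
        rw [← hs, List.getElem?_append_left hi']
    rw [h1]
    change _ = some ((spell ϱ x (i + 1)).getD i (Classical.arbitrary B))
    rw [List.getD_eq_getElem _ _ hi', List.getElem?_eq_getElem hi']
  apply List.ext_getElem?
  intro i
  rw [List.getElem?_ofFn, List.getElem?_take]
  split_ifs with hi
  · rw [List.getElem?_drop, key _ (by omega), firstWord, shift_iterate_apply]
    push_cast
    rw [add_comm]
  · rfl

theorem ofFn_firstWord_extend [Nonempty B] {ϱ : A → List B} (hϱ : ∀ a, ϱ a ≠ [])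
    (x : ℤ → A) {N T : ℕ} (hT : N ≤ (spell ϱ x T).length) :
    List.ofFn (firstWord N (extend ϱ x)) = (spell ϱ x T).take N :=
  ofFn_firstWord_shift_extend hϱ x (j := 0) hT

open Classical in
/-- Words spelled by two sequences have a common sublist, missing only the letters
where the sequences differ. -/
theorem exists_common_sublist_spell {ϱ : A → List B} {c : ℕ} (h : ∀ a, (ϱ a).length ≤ c)
    (x y : ℤ → A) (T : ℕ) :
    ∃ w : List B, w.Sublist (spell ϱ x T) ∧ w.Sublist (spell ϱ y T) ∧
      (spell ϱ x T).length ≤ w.length + c * ∑ i ∈ Finset.range T, (if x i = y i then 0 else 1) ∧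
      (spell ϱ y T).length ≤ w.length + c * ∑ i ∈ Finset.range T, (if x i = y i then 0 else 1) := by
  induction T with
  | zero => exact ⟨[], List.nil_sublist _, List.nil_sublist _, by simp [spell], by simp [spell]⟩
  | succ T ih =>
    obtain ⟨w, h1, h2, h3, h4⟩ := ih
    rw [spell_succ, spell_succ, Finset.sum_range_succ]
    by_cases hxy : x T = y T
    · refine ⟨w ++ ϱ (x T), h1.append (List.Sublist.refl _), ?_, ?_, ?_⟩
      · rw [← hxy]
        exact h2.append (List.Sublist.refl _)
      · simp only [List.length_append, hxy, if_true, add_zero]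
        omega
      · simp only [List.length_append, hxy, if_true, add_zero]
        omega
    · refine ⟨w, h1.trans (List.sublist_append_left _ _), h2.trans (List.sublist_append_left _ _),
        ?_, ?_⟩
      · have := h (x T)
        simp only [List.length_append, hxy, if_false, mul_add, mul_one]
        omega
      · have := h (y T)
        simp only [List.length_append, hxy, if_false, mul_add, mul_one]
        omega

open Classical in
-- The shift loses at most `c` letters of the common sublist and each disagreement of `x` and `y` at
-- most `c` more. The condition on `T` ensures that `T` words reach position `N` even after the
-- shift.
theorem editDist_shift_extend_le [Nonempty B] {ϱ : A → List B} (hϱ : ∀ a, ϱ a ≠ []) {c₀ c : ℕ}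
    (h₀ : ∀ a, c₀ ≤ (ϱ a).length) (h : ∀ a, (ϱ a).length ≤ c) (x y : ℤ → A) {N j T : ℕ}
    (hN : 0 < N) (hj : j ≤ c) (hT : N + c ≤ T * c₀) :
    editDist (firstWord N (shift^[j] (extend ϱ y))) (firstWord N (extend ϱ x)) ≤
      (c + c * ∑ i ∈ Finset.range T, (if y i = x i then 0 else 1) : ℕ) / N := by
  obtain ⟨w, h1, h2, h3, h4⟩ := exists_common_sublist_spell h y x T
  have hx := mul_le_length_spell h₀ x T
  have hy := mul_le_length_spell h₀ y T
  refine editDist_le_of_sublist (w := w.drop j) hN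
    (ofFn_firstWord_shift_extend hϱ y (T := T) (by omega))
    (ofFn_firstWord_extend hϱ x (T := T) (by omega)) (h1.drop j)
    ((List.drop_sublist _ _).trans h2) ?_ ?_
  · simp only [List.length_drop]
    omega
  · simp only [List.length_drop]
    omega

end Spell

/-! ### Measurability of coded sequences -/

section Measurability

variable {A B : Type*} [MeasurableSpace A] [MeasurableSpace B]

theorem measurable_of_finite_dependence [Finite A] [Nonempty A] [DiscreteMeasurableSpace A]
    {f : (ℤ → A) → B} (s : Finset ℤ) (h : ∀ x y, (∀ i ∈ s, x i = y i) → f x = f y) :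
    Measurable f := by
  classical
  let e : (s → A) → ℤ → A := fun y i => if hi : i ∈ s then y ⟨i, hi⟩ else Classical.arbitrary A
  have hf : f = (f ∘ e) ∘ fun x (i : s) => x i := by
    funext x
    apply h
    intro i hi
    simp [e, hi]
  rw [hf]
  exact Measurable.of_discrete.comp (measurable_pi_lambda _ fun _ => measurable_pi_apply _)

theorem measurable_shift : Measurable (shift : (ℤ → B) → ℤ → B) :=
  measurable_pi_lambda _ fun _ => measurable_pi_apply _

theorem measurable_extend [Finite A] [Nonempty A] [DiscreteMeasurableSpace A] [Nonempty B]
    (ϱ : A → List B) : Measurable (extend ϱ) := by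
  refine measurable_pi_lambda _ fun k => ?_
  rcases k with i | i
  · refine measurable_of_finite_dependence ((Finset.range (i + 1)).image fun n : ℕ => (n : ℤ)) ?_
    intro x y h
    simp only [extend]
    congr 1
    refine List.flatMap_congr fun n hn => ?_
    rw [h _ (Finset.mem_image_of_mem _ (by simpa using hn))]
  · refine measurable_of_finite_dependence ((Finset.range (i + 1)).image Int.negSucc) ?_
    intro x y h
    simp only [extend]
    congr 1
    refine List.flatMap_congr fun n hn => ?_
    rw [h _ (Finset.mem_image_of_mem _ (by simpa using hn))]

theorem measurable_shift_extend [Finite A] [Nonempty A] [DiscreteMeasurableSpace A] [Nonempty B]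
    (ϱ : A → List B) (j : ℕ) : Measurable (shift^[j] ∘ extend ϱ) :=
  (measurable_shift.iterate j).comp (measurable_extend ϱ)

theorem measurableSet_letterCylinder [DiscreteMeasurableSpace A] (a : A) :
    MeasurableSet (letterCylinder a) :=
  (measurable_pi_apply (0 : ℤ) : Measurable fun x : ℤ → A => x 0) (MeasurableSet.singleton a)

end Measurability

/-! ### Couplings of probability vectors -/

section LetterLaw

variable {A : Type*} [Fintype A] [MeasurableSpace A] [DiscreteMeasurableSpace A]

theorem letterLaw_apply (p : A → ℝ) (s : Set A) :
    letterLaw p s = ∑ a, s.indicator (fun a => ENNReal.ofReal (p a)) a := by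
  simp only [letterLaw, Measure.coe_finsetSum, Finset.sum_apply, Measure.smul_apply,
    Measure.dirac_apply, smul_eq_mul]
  refine Finset.sum_congr rfl fun a _ => ?_
  by_cases h : a ∈ s <;> simp [h]

theorem letterLaw_singleton (p : A → ℝ) (a : A) : letterLaw p {a} = ENNReal.ofReal (p a) := by
  classical
  rw [letterLaw_apply, Finset.sum_eq_single a] <;> simp +contextual

theorem isProbabilityMeasure_letterLaw {p : A → ℝ} (hp : p ∈ stdSimplex ℝ A) :
    IsProbabilityMeasure (letterLaw p) := by
  constructor
  rw [letterLaw_apply]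
  simp only [Set.indicator_univ]
  rw [← ENNReal.ofReal_sum_of_nonneg fun a _ => hp.1 a, hp.2, ENNReal.ofReal_one]

/-- Two probability vectors have a coupling which charges the complement of the diagonal at most
by their `ℓ¹`-distance. -/
theorem exists_coupling {p q : A → ℝ} (hp : p ∈ stdSimplex ℝ A) (hq : q ∈ stdSimplex ℝ A) :
    ∃ π : Measure (A × A), IsProbabilityMeasure π ∧ π.map Prod.fst = letterLaw p ∧
      π.map Prod.snd = letterLaw q ∧
      π {z | z.1 ≠ z.2} ≤ ENNReal.ofReal (∑ a, |p a - q a|) := by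
  classical
  let r : A → ℝ := fun a => p a - min (p a) (q a)
  let s : A → ℝ := fun a => q a - min (p a) (q a)
  let τ : ℝ := ∑ a, r a
  have hr : ∀ a, 0 ≤ r a := fun a => sub_nonneg.2 (min_le_left _ _)
  have hs : ∀ a, 0 ≤ s a := fun a => sub_nonneg.2 (min_le_right _ _)
  have hτs : ∑ a, s a = τ := by
    simp only [τ, r, s, Finset.sum_sub_distrib, hp.2, hq.2]
  have hτ : 0 ≤ τ := Finset.sum_nonneg fun a _ => hr a
  -- If `τ = 0` then `p = q` and all excesses vanish, so the convention `0⁻¹ = 0` is harmless.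
  have hr' : ∀ a, τ⁻¹ * r a * τ = r a := by
    intro a
    rcases eq_or_ne τ 0 with h | h
    · rw [(Finset.sum_eq_zero_iff_of_nonneg fun a _ => hr a).1 h a (Finset.mem_univ _)]
      simp
    · field_simp
  have hs' : ∀ a, τ⁻¹ * s a * τ = s a := by
    intro a
    rcases eq_or_ne τ 0 with h | h
    · rw [(Finset.sum_eq_zero_iff_of_nonneg fun a _ => hs a).1 (hτs.trans h) a (Finset.mem_univ _)]
      simp
    · field_simp
  -- The maximal coupling: the common mass `min p q` sits on the diagonal, and the excesses `r` and
  -- `s`, both of total mass `τ`, are coupled independently. Mass off the diagonal comes only from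
  -- the second summand, hence is at most `τ`.
  let g : A × A → ℝ := fun z =>
    (if z.1 = z.2 then min (p z.1) (q z.1) else 0) + τ⁻¹ * r z.1 * s z.2
  have hg' : ∀ a b, 0 ≤ τ⁻¹ * r a * s b := fun a b =>
    mul_nonneg (mul_nonneg (inv_nonneg.2 hτ) (hr a)) (hs b)
  have hg : ∀ z, 0 ≤ g z := by
    intro z
    refine add_nonneg ?_ (hg' _ _)
    split_ifs
    · exact le_min (hp.1 _) (hq.1 _)
    · exact le_rfl
  have hrow : ∀ a, ∑ b, g (a, b) = p a := by
    intro a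
    simp only [g, Finset.sum_add_distrib, ← Finset.mul_sum, hτs, hr']
    simp [r]
  have hcol : ∀ b, ∑ a, g (a, b) = q b := by
    intro b
    simp only [g, Finset.sum_add_distrib]
    have : ∑ a, τ⁻¹ * r a * s b = s b := by
      rw [← hs' b, ← Finset.sum_mul, ← Finset.mul_sum]
      change τ⁻¹ * τ * _ = _
      rw [hs' b]
      nth_rewrite 2 [← hs' b]
      ring
    rw [this]
    simp [s]
  have hfst : (letterLaw g).map Prod.fst = letterLaw p := by
    refine Measure.ext_of_singleton fun a => ?_
    rw [Measure.map_apply measurable_fst (MeasurableSet.singleton a), letterLaw_singleton,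
      letterLaw_apply, Fintype.sum_prod_type, Finset.sum_eq_single a, ← hrow,
      ENNReal.ofReal_sum_of_nonneg fun b _ => hg _]
    · simp
    · intro b _ hb
      simp [hb]
    · simp
  have hsnd : (letterLaw g).map Prod.snd = letterLaw q := by
    refine Measure.ext_of_singleton fun a => ?_
    rw [Measure.map_apply measurable_snd (MeasurableSet.singleton a), letterLaw_singleton,
      letterLaw_apply, Fintype.sum_prod_type_right, Finset.sum_eq_single a, ← hcol,
      ENNReal.ofReal_sum_of_nonneg fun b _ => hg _]
    · simp
    · intro b _ hb
      simp [hb]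
    · simp
  refine ⟨letterLaw g, ?_, hfst, hsnd, ?_⟩
  · apply isProbabilityMeasure_letterLaw
    refine ⟨hg, ?_⟩
    rw [Fintype.sum_prod_type, ← hp.2]
    exact Finset.sum_congr rfl fun a _ => hrow a
  · rw [letterLaw_apply]
    have h1 : ∑ z : A × A, {z : A × A | z.1 ≠ z.2}.indicator (fun z => ENNReal.ofReal (g z)) z ≤
        ∑ z : A × A, ENNReal.ofReal (τ⁻¹ * r z.1 * s z.2) := by
      refine Finset.sum_le_sum fun z _ => ?_
      by_cases hz : z.1 = z.2
      · simp [hz]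
      · simp [hz, g]
    refine h1.trans ?_
    rw [← ENNReal.ofReal_sum_of_nonneg fun z _ => hg' _ _]
    refine ENNReal.ofReal_le_ofReal ?_
    rw [Fintype.sum_prod_type]
    simp only [← Finset.mul_sum, hτs, hr']
    refine Finset.sum_le_sum fun a _ => ?_
    simp only [r]
    rcases le_total (p a) (q a) with h | h
    · simp [h]
    · simp [h, le_abs_self]

end LetterLaw

/-! ### The measures `κ_inv` -/

section Kappa

variable {A B : Type*} [Fintype A] [MeasurableSpace A] [DiscreteMeasurableSpace A]

theorem sum_restrict_fiber {Ω : Type*} [MeasurableSpace Ω] (μ : Measure Ω) {f : Ω → A}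
    (hf : Measurable f) : ∑ a, μ.restrict (f ⁻¹' {a}) = μ := by
  rw [← Measure.sum_fintype, ← Measure.restrict_iUnion]
  · rw [← Set.preimage_iUnion, Set.iUnion_of_singleton, Set.preimage_univ, Measure.restrict_univ]
  · intro a b hab
    exact Set.disjoint_left.2 fun x hx hx' => hab (by rw [← show f x = a from hx]; exact hx')
  · exact fun a => hf (MeasurableSet.singleton a)

theorem sum_inv_smul_sum_const {M : Type*} [AddCommMonoid M] [Module ℝ≥0∞ M] {n : ℕ} (hn : n ≠ 0)
    (x : M) : (n : ℝ≥0∞)⁻¹ • ∑ _j ∈ Finset.range n, x = x := by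
  rw [Finset.sum_const, Finset.card_range, ← Nat.cast_smul_eq_nsmul ℝ≥0∞, smul_smul,
    ENNReal.inv_mul_cancel (by exact_mod_cast hn) (ENNReal.natCast_ne_top n), one_smul]

variable [Nonempty A] [Nonempty B] [MeasurableSpace B]

theorem isProbabilityMeasure_kappaInv {ϱ : A → List B} (hϱ : ∀ a, ϱ a ≠ [])
    (P : Measure (ℤ → A)) [IsProbabilityMeasure P] : IsProbabilityMeasure (kappaInv ϱ P) := by
  constructor
  simp only [kappaInv, Measure.coe_finsetSum, Finset.sum_apply, Measure.smul_apply,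
    Measure.map_apply (measurable_shift_extend ϱ _) MeasurableSet.univ, Set.preimage_univ]
  have h : ∀ a, (ϱ a).length ≠ 0 := fun a => by simpa using hϱ a
  simp only [sum_inv_smul_sum_const (h _)]
  have := congrArg (fun μ => μ Set.univ)
    (sum_restrict_fiber P (measurable_pi_apply 0 : Measurable fun x : ℤ → A => x 0))
  simpa [letterCylinder, Set.preimage] using this

variable [Finite B] [DiscreteMeasurableSpace B]

/-- A measure `κ_inv(A, ϱ, P)` with `P` Bernoulli is close to the image under `ϱ` of a Bernoulli
measure with similar weights. -/
theorem close_kappaInv_bernoulli {ϱ : A → List B} {c₀ c : ℕ} (hc₀ : 0 < c₀)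
    (h₀ : ∀ a, c₀ ≤ (ϱ a).length) (h : ∀ a, (ϱ a).length ≤ c) {p q : A → ℝ}
    (hp : p ∈ stdSimplex ℝ A) (hq : q ∈ stdSimplex ℝ A) {τ : ℝ} (hτ : ∑ a, |p a - q a| ≤ τ) :
    ∃ K : ℝ, 0 ≤ K ∧ ∀ N : ℕ, 0 < N → Close N (ENNReal.ofReal ((c : ℝ) / c₀ * τ + K / N))
      (kappaInv ϱ (bernoulli p)) ((bernoulli q).map (extend ϱ)) := by
  classical
  have hϱ : ∀ a, ϱ a ≠ [] := fun a => by
    have := h₀ a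
    exact List.ne_nil_of_length_pos (by omega)
  have hl : ∀ a, (ϱ a).length ≠ 0 := fun a => by simpa using hϱ a
  have hτ0 : 0 ≤ τ := (Finset.sum_nonneg fun a _ => abs_nonneg _).trans hτ
  obtain ⟨π, hπ, hπ1, hπ2, hπ3⟩ := exists_coupling hp hq
  -- I.i.d. pairs of coupled letters: `Y` has law `bernoulli p`, `X` has law `bernoulli q`, and they
  -- disagree at any given position with probability at most `τ`.
  let Q : Measure (ℤ → A × A) := Measure.infinitePi fun _ => π
  let Y : (ℤ → A × A) → ℤ → A := fun ω i => (ω i).1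
  let X : (ℤ → A × A) → ℤ → A := fun ω i => (ω i).2
  have hY : Measurable Y :=
    measurable_pi_lambda _ fun i => measurable_fst.comp (measurable_pi_apply i)
  have hX : Measurable X :=
    measurable_pi_lambda _ fun i => measurable_snd.comp (measurable_pi_apply i)
  have hQY : Q.map Y = bernoulli p := by
    rw [bernoulli, ← hπ1]
    exact Measure.infinitePi_map_pi (μ := fun _ : ℤ => π) (f := fun _ z => z.1)
      fun _ => measurable_fst
  have hQX : Q.map X = bernoulli q := by
    rw [bernoulli, ← hπ2]
    exact Measure.infinitePi_map_pi (μ := fun _ : ℤ => π) (f := fun _ z => z.2)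
      fun _ => measurable_snd
  have hY0 : Measurable fun ω => Y ω 0 := (measurable_pi_apply 0).comp hY
  -- The contribution of the shift and of the `c + 1` letters of `T` in excess of `N / c₀`.
  refine ⟨c + c * (c + 1) * τ, by positivity, fun N hN => ?_⟩
  let F : ℕ → (ℤ → A × A) → Fin N → B := fun j ω => firstWord N (shift^[j] (extend ϱ (Y ω)))
  let G : (ℤ → A × A) → Fin N → B := fun ω => firstWord N (extend ϱ (X ω))
  have hF : ∀ j, Measurable (F j) := fun j =>
    (measurable_firstWord N).comp ((measurable_shift_extend ϱ j).comp hY)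
  have hG : Measurable G := (measurable_firstWord N).comp ((measurable_extend ϱ).comp hX)
  -- Given `Y 0 = a`, the shift `j` is uniform below `|ϱ(a)|` and acts on the coding of `Y` only. It
  -- therefore averages out in the second marginal.
  let γ : Measure ((Fin N → B) × (Fin N → B)) :=
    ∑ a, ((ϱ a).length : ℝ≥0∞)⁻¹ • ∑ j ∈ Finset.range (ϱ a).length,
      (Q.restrict ((fun ω => Y ω 0) ⁻¹' {a})).map fun ω => (F j ω, G ω)
  refine ⟨γ, ⟨?_, ?_⟩, ?_⟩
  · have e1 : γ.map Prod.fst = ∑ a, ((ϱ a).length : ℝ≥0∞)⁻¹ • ∑ j ∈ Finset.range (ϱ a).length,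
        (Q.restrict ((fun ω => Y ω 0) ⁻¹' {a})).map (F j) := by
      simp only [γ]
      rw [Measure.map_finset_sum measurable_fst.aemeasurable]
      refine Finset.sum_congr rfl fun a _ => ?_
      rw [Measure.map_smul, Measure.map_finset_sum measurable_fst.aemeasurable]
      congr 1
      refine Finset.sum_congr rfl fun j _ => ?_
      rw [Measure.map_map measurable_fst ((hF j).prodMk hG)]
      rfl
    rw [e1, wordLaw, kappaInv, Measure.map_finset_sum (measurable_firstWord N).aemeasurable]
    refine Finset.sum_congr rfl fun a _ => ?_
    rw [Measure.map_smul, Measure.map_finset_sum (measurable_firstWord N).aemeasurable]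
    congr 1
    refine Finset.sum_congr rfl fun j _ => ?_
    rw [Measure.map_map (measurable_firstWord N) (measurable_shift_extend ϱ j), ← hQY,
      Measure.restrict_map hY (measurableSet_letterCylinder a),
      Measure.map_map ((measurable_firstWord N).comp (measurable_shift_extend ϱ j)) hY]
    rfl
  · have e1 : γ.map Prod.snd = ∑ a, (Q.restrict ((fun ω => Y ω 0) ⁻¹' {a})).map G := by
      simp only [γ]
      rw [Measure.map_finset_sum measurable_snd.aemeasurable]
      refine Finset.sum_congr rfl fun a _ => ?_
      rw [Measure.map_smul, Measure.map_finset_sum measurable_snd.aemeasurable]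
      conv_rhs => rw [← sum_inv_smul_sum_const (hl a) ((Q.restrict _).map G)]
      congr 1
      refine Finset.sum_congr rfl fun j _ => ?_
      rw [Measure.map_map measurable_snd ((hF j).prodMk hG)]
      rfl
    rw [e1, ← Measure.map_finset_sum hG.aemeasurable, sum_restrict_fiber Q hY0, wordLaw, ← hQX,
      Measure.map_map (measurable_extend ϱ) hX,
      Measure.map_map (measurable_firstWord N) ((measurable_extend ϱ).comp hX)]
    rfl
  · let T : ℕ := N / c₀ + c + 1
    have hT : N + c ≤ T * c₀ := by
      have h1 := Nat.div_add_mod N c₀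
      have h2 := Nat.mod_lt N hc₀
      have h3 : c * 1 ≤ c * c₀ := Nat.mul_le_mul_left c hc₀
      have h4 : T * c₀ = c₀ * (N / c₀) + c * c₀ + c₀ := by simp only [T]; ring
      omega
    let D : Set (A × A) := {z | z.1 ≠ z.2}
    -- This bound on the edit distance does not involve `a` and `j`, so its integral against the
    -- shift-averaged joining is an integral against `Q`.
    let g : (ℤ → A × A) → ℝ≥0∞ := fun ω =>
      (c + c * ∑ i ∈ Finset.range T, D.indicator 1 (ω i)) / N
    have hD : ∀ i : ℤ, Measurable fun ω : ℤ → A × A => D.indicator (1 : A × A → ℝ≥0∞) (ω i) :=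
      fun i => (Measurable.of_discrete (f := D.indicator (1 : A × A → ℝ≥0∞))).comp
        (measurable_pi_apply i)
    have hle : ∀ a, ∀ j ∈ Finset.range (ϱ a).length, ∀ ω,
        ENNReal.ofReal (editDist (F j ω) (G ω)) ≤ g ω := by
      intro a j hj ω
      have hj' : j ≤ c := (Finset.mem_range.1 hj).le.trans (h a)
      refine (ENNReal.ofReal_le_ofReal
        (editDist_shift_extend_le hϱ h₀ h (X ω) (Y ω) hN hj' hT)).trans ?_
      rw [ENNReal.ofReal_div_of_pos (by exact_mod_cast hN), ENNReal.ofReal_natCast,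
        ENNReal.ofReal_natCast]
      refine le_of_eq ?_
      simp only [g, Nat.cast_add, Nat.cast_mul, Nat.cast_sum]
      congr 4
      ext i
      by_cases hi : (ω i).1 = (ω i).2 <;> simp [X, Y, D, hi]
    have h1 : ∫⁻ w, ENNReal.ofReal (editDist w.1 w.2) ∂γ ≤ ∫⁻ ω, g ω ∂Q := by
      conv_rhs => rw [← sum_restrict_fiber Q hY0]
      simp only [γ, lintegral_finsetSum_measure, lintegral_smul_measure]
      refine Finset.sum_le_sum fun a _ => ?_
      conv_rhs => rw [← sum_inv_smul_sum_const (hl a) (∫⁻ ω, g ω ∂_)]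
      rw [smul_eq_mul, smul_eq_mul]
      gcongr with j hj
      rw [lintegral_map Measurable.of_discrete ((hF j).prodMk hG)]
      exact lintegral_mono fun ω => hle a j hj ω
    have h2 : ∀ i : ℤ, ∫⁻ ω, D.indicator 1 (ω i) ∂Q ≤ ENNReal.ofReal τ := by
      intro i
      rw [← lintegral_map (μ := Q) (f := D.indicator 1) (g := fun ω => ω i)
        Measurable.of_discrete (measurable_pi_apply i),
        Measure.infinitePi_map_eval (fun _ => π) i,
        lintegral_indicator_one MeasurableSet.of_discrete]
      exact hπ3.trans (ENNReal.ofReal_le_ofReal hτ)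
    have h3 : ∫⁻ ω, g ω ∂Q ≤ (c + c * (T * ENNReal.ofReal τ)) / N := by
      simp only [g, div_eq_mul_inv]
      rw [lintegral_mul_const _ (by fun_prop), lintegral_add_left measurable_const,
        lintegral_const_mul _ (by fun_prop), lintegral_finsetSum _ fun (i : ℕ) _ => hD i]
      gcongr
      · simp [Q]
      · refine (Finset.sum_le_card_nsmul _ _ _ fun (i : ℕ) _ => h2 i).trans ?_
        simp
    refine h1.trans (h3.trans ?_)
    have h4 : ((c + c * (T * ENNReal.ofReal τ)) / N : ℝ≥0∞) =
        ENNReal.ofReal ((c + c * (T * τ)) / N) := by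
      rw [ENNReal.ofReal_div_of_pos (by exact_mod_cast hN),
        ENNReal.ofReal_add (by positivity) (by positivity), ENNReal.ofReal_mul (by positivity),
        ENNReal.ofReal_mul (by positivity)]
      simp only [ENNReal.ofReal_natCast]
    rw [h4]
    refine ENNReal.ofReal_le_ofReal ?_
    have hN' : (0 : ℝ) < N := by exact_mod_cast hN
    have hT' : (T : ℝ) ≤ N / c₀ + c + 1 := by
      simp only [T]
      push_cast
      gcongr
      exact Nat.cast_div_le
    have h5 : (c : ℝ) / c₀ * τ + (c + c * (c + 1) * τ) / N =
        (c + c * ((N / c₀ + c + 1) * τ)) / N := by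
      field_simp
      ring
    rw [h5]
    gcongr

end Kappa

/-! ### Comparison of the levels of a cascade -/

section Levels

variable {A : Type*} {m : ℕ → ℕ}

instance instDiscreteMeasurableSpaceLevel [Finite A] [MeasurableSpace A]
    [DiscreteMeasurableSpace A] : (n : ℕ) → DiscreteMeasurableSpace (Level A m n)
  | 0 => inferInstanceAs (DiscreteMeasurableSpace A)
  | n + 1 =>
      haveI := instDiscreteMeasurableSpaceLevel n
      haveI : Finite (Level A m n) := by
        cases nonempty_fintype A
        infer_instance
      inferInstanceAs (DiscreteMeasurableSpace (Fin (m (n + 1)) → Level A m n))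

instance instNonemptyLevel [Nonempty A] : (n : ℕ) → Nonempty (Level A m n)
  | 0 => inferInstanceAs (Nonempty A)
  | n + 1 =>
      haveI := instNonemptyLevel n
      inferInstanceAs (Nonempty (Fin (m (n + 1)) → Level A m n))

theorem measurable_blocks {C : Type*} [MeasurableSpace C] (r : ℕ) :
    Measurable (blocks r : (ℤ → C) → ℤ → Fin r → C) :=
  measurable_pi_lambda _ fun _ => measurable_pi_lambda _ fun _ => measurable_pi_apply _

theorem measurable_toLevel [MeasurableSpace A] (n : ℕ) :
    Measurable (toLevel m n : (ℤ → A) → ℤ → Level A m n) := by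
  induction n with
  | zero => exact measurable_id
  | succ n ih => exact (measurable_blocks (m (n + 1))).comp ih

/-- The number of letters of `A` in a letter of `A_n`. -/
def blockLength (m : ℕ → ℕ) (n : ℕ) : ℕ := ∏ i ∈ Finset.range n, m (i + 1)

theorem blockLength_succ (n : ℕ) : blockLength m (n + 1) = m (n + 1) * blockLength m n := by
  rw [blockLength, Finset.prod_range_succ, mul_comm, ← blockLength]

theorem blockLength_pos (hm : ∀ n, 1 ≤ n → 2 ≤ m n) (n : ℕ) : 0 < blockLength m n :=
  Finset.prod_pos fun i _ => by have := hm (i + 1) (by omega); omega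

variable {B : Type*} {ϱ₀ : A → List B} {t : (n : ℕ) → Level A m n → List B}

theorem length_cascade_succ (n : ℕ) (a : Level A m (n + 1)) :
    (cascade m ϱ₀ t (n + 1) a).length =
      ∑ i : Fin (m (n + 1)), (cascade m ϱ₀ t n (a i)).length + (t (n + 1) a).length := by
  rw [cascade, List.length_append, List.length_flatten, List.map_ofFn, List.sum_ofFn]
  rfl

theorem le_length_cascade {L : ℕ} (h₀ : ∀ a, (ϱ₀ a).length = L) (n : ℕ) (a : Level A m n) :
    blockLength m n * L ≤ (cascade m ϱ₀ t n a).length := by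
  induction n with
  | zero =>
    change blockLength m 0 * L ≤ (ϱ₀ a).length
    rw [h₀ a]
    simp [blockLength]
  | succ n ih =>
    rw [length_cascade_succ, blockLength_succ]
    have := Finset.card_nsmul_le_sum Finset.univ
      (fun i : Fin (m (n + 1)) => (cascade m ϱ₀ t n (a i)).length) _ fun i _ => ih (a i)
    simp only [Finset.card_univ, Fintype.card_fin, smul_eq_mul, ← mul_assoc] at this
    omega

theorem cascade_ne_nil (hm : ∀ n, 1 ≤ n → 2 ≤ m n) {L : ℕ} (hL : 0 < L)
    (h₀ : ∀ a, (ϱ₀ a).length = L) (n : ℕ) (a : Level A m n) : cascade m ϱ₀ t n a ≠ [] :=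
  List.ne_nil_of_length_pos
    ((Nat.mul_pos (blockLength_pos hm n) hL).trans_le (le_length_cascade h₀ n a))

/-- The induction step, by `1 + x ≤ exp x`, for bounding `∏ (1 + K 2⁻ⁱ)` over `k < i ≤ n`; the
exponent is the geometric sum `K (2⁻ᵏ - 2⁻ⁿ)`. -/
theorem one_add_mul_exp_le (K : ℝ) (k n : ℕ) :
    (1 + K * (2 : ℝ)⁻¹ ^ (n + 1)) * Real.exp (K * ((2 : ℝ)⁻¹ ^ k - (2 : ℝ)⁻¹ ^ n)) ≤
      Real.exp (K * ((2 : ℝ)⁻¹ ^ k - (2 : ℝ)⁻¹ ^ (n + 1))) := by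
  have h : K * ((2 : ℝ)⁻¹ ^ k - (2 : ℝ)⁻¹ ^ (n + 1)) =
      K * (2 : ℝ)⁻¹ ^ (n + 1) + K * ((2 : ℝ)⁻¹ ^ k - (2 : ℝ)⁻¹ ^ n) := by
    rw [pow_succ]
    ring
  rw [h, Real.exp_add]
  gcongr
  linarith [Real.add_one_le_exp (K * (2 : ℝ)⁻¹ ^ (n + 1))]

/-- The bound on the lengths of tails. -/
def TailBound (m : ℕ → ℕ) (ϱ₀ : A → List B) (t : (n : ℕ) → Level A m n → List B) (K : ℝ) : Prop :=
  ∀ (n : ℕ) (a : Level A m (n + 1)), ((t (n + 1) a).length : ℝ) ≤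
      K * (2 : ℝ)⁻¹ ^ (n + 1) * ∑ i : Fin (m (n + 1)), ((cascade m ϱ₀ t n (a i)).length : ℝ)

variable {K : ℝ}

theorem TailBound.length_cascade_succ_le (hK : TailBound m ϱ₀ t K) (n : ℕ)
    (a : Level A m (n + 1)) :
    ((cascade m ϱ₀ t (n + 1) a).length : ℝ) ≤ (1 + K * (2 : ℝ)⁻¹ ^ (n + 1)) *
      ∑ i : Fin (m (n + 1)), ((cascade m ϱ₀ t n (a i)).length : ℝ) := by
  have := hK n a
  rw [length_cascade_succ]
  push_cast
  linarith

/-- With `le_length_cascade`, this confines all words of a level to lengths within a factor `exp K`,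
independently of the level. -/
theorem TailBound.length_cascade_le (hK0 : 0 ≤ K) (hK : TailBound m ϱ₀ t K) {L : ℕ}
    (h₀ : ∀ a, (ϱ₀ a).length = L) (n : ℕ) (a : Level A m n) :
    ((cascade m ϱ₀ t n a).length : ℝ) ≤ Real.exp K * (blockLength m n * L) := by
  have key : ((cascade m ϱ₀ t n a).length : ℝ) ≤
      Real.exp (K * ((2 : ℝ)⁻¹ ^ 0 - (2 : ℝ)⁻¹ ^ n)) * (blockLength m n * L) := by
    induction n with
    | zero =>
      change ((ϱ₀ a).length : ℝ) ≤ _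
      rw [h₀ a]
      simp [blockLength]
    | succ n ih =>
      refine (hK.length_cascade_succ_le n a).trans ?_
      have h1 : ∑ i : Fin (m (n + 1)), ((cascade m ϱ₀ t n (a i)).length : ℝ) ≤
          m (n + 1) * (Real.exp (K * ((2 : ℝ)⁻¹ ^ 0 - (2 : ℝ)⁻¹ ^ n)) * (blockLength m n * L)) := by
        have := Finset.sum_le_card_nsmul Finset.univ
          (fun i : Fin (m (n + 1)) => ((cascade m ϱ₀ t n (a i)).length : ℝ)) _ fun i _ => ih (a i)
        simpa using this
      have h2 : (0 : ℝ) ≤ 1 + K * (2 : ℝ)⁻¹ ^ (n + 1) := by positivity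
      refine (mul_le_mul_of_nonneg_left h1 h2).trans ?_
      have h3 := mul_le_mul_of_nonneg_right (one_add_mul_exp_le K 0 n)
        (by positivity : (0 : ℝ) ≤ m (n + 1) * (blockLength m n * L))
      rw [blockLength_succ]
      push_cast
      linarith
  refine key.trans ?_
  gcongr
  have : (0 : ℝ) < (2 : ℝ)⁻¹ ^ n := by positivity
  rw [pow_zero]
  nlinarith

theorem spell_add (ϱ : A → List B) (x : ℤ → A) (S R : ℕ) :
    spell ϱ x (S + R) =
      spell ϱ x S ++ (List.ofFn fun j : Fin R => ϱ (x (S + (j : ℕ)))).flatten := by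
  induction R with
  | zero => simp
  | succ R ih =>
    rw [← add_assoc, spell_succ, ih, List.ofFn_succ']
    simp

/-- The words spelled on two consecutive levels. -/
theorem TailBound.spell_succ_level (hK : TailBound m ϱ₀ t K) (n : ℕ) (x : ℤ → A) (S : ℕ) :
    (spell (cascade m ϱ₀ t n) (toLevel m n x) (S * m (n + 1))).Sublist
        (spell (cascade m ϱ₀ t (n + 1)) (toLevel m (n + 1) x) S) ∧
      ((spell (cascade m ϱ₀ t (n + 1)) (toLevel m (n + 1) x) S).length : ℝ) ≤
        (1 + K * (2 : ℝ)⁻¹ ^ (n + 1)) *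
          (spell (cascade m ϱ₀ t n) (toLevel m n x) (S * m (n + 1))).length := by
  induction S with
  | zero => simp [spell]
  | succ S ih =>
    have e : (List.ofFn fun j : Fin (m (n + 1)) =>
          cascade m ϱ₀ t n (toLevel m n x ((S * m (n + 1) : ℕ) + (j : ℕ)))) =
        List.ofFn fun j : Fin (m (n + 1)) => cascade m ϱ₀ t n (toLevel m (n + 1) x S j) := by
      simp only [toLevel, blocks, Nat.cast_mul]
    rw [add_mul, one_mul, spell_add, spell_succ, e]
    constructor
    · exact ih.1.append (List.sublist_append_left _ _)
    · have h := hK.length_cascade_succ_le n (toLevel m (n + 1) x S)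
      rw [List.length_append, List.length_append, List.length_flatten, List.map_ofFn,
        List.sum_ofFn]
      push_cast
      rw [mul_add]
      exact add_le_add ih.2 h

/-- `R` is `m_{k+1} ⋯ m_{k+d}`, the number of letters of level `k` in one of level `k + d`. Only
tails are deleted in passing to the sublist. -/
theorem TailBound.spell_add_level (hm : ∀ n, 1 ≤ n → 2 ≤ m n) (hK0 : 0 ≤ K)
    (hK : TailBound m ϱ₀ t K) (k d : ℕ) :
    ∃ R : ℕ, 0 < R ∧ ∀ (x : ℤ → A) (S : ℕ),
      (spell (cascade m ϱ₀ t k) (toLevel m k x) (S * R)).Sublist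
        (spell (cascade m ϱ₀ t (k + d)) (toLevel m (k + d) x) S) ∧
      ((spell (cascade m ϱ₀ t (k + d)) (toLevel m (k + d) x) S).length : ℝ) ≤
        Real.exp (K * ((2 : ℝ)⁻¹ ^ k - (2 : ℝ)⁻¹ ^ (k + d))) *
          (spell (cascade m ϱ₀ t k) (toLevel m k x) (S * R)).length := by
  induction d with
  | zero => exact ⟨1, one_pos, fun x S => by simp⟩
  | succ d ih =>
    obtain ⟨R, hR, h⟩ := ih
    refine ⟨m (k + d + 1) * R, Nat.mul_pos (by have := hm (k + d + 1) (by omega); omega) hR,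
      fun x S => ?_⟩
    obtain ⟨h1, h2⟩ := h x (S * m (k + d + 1))
    obtain ⟨h3, h4⟩ := hK.spell_succ_level (k + d) x S
    rw [mul_assoc] at h1 h2
    refine ⟨h1.trans h3, h4.trans ((mul_le_mul_of_nonneg_left h2 (by positivity)).trans ?_)⟩
    rw [← mul_assoc]
    exact mul_le_mul_of_nonneg_right (one_add_mul_exp_le K k (k + d)) (Nat.cast_nonneg _)

/-- The images of a measure under the substitutions of two levels are close. -/
theorem TailBound.close_map_extend [Finite A] [Nonempty A] [MeasurableSpace A]
    [DiscreteMeasurableSpace A] [Finite B] [Nonempty B] [MeasurableSpace B]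
    [DiscreteMeasurableSpace B]
    (hm : ∀ n, 1 ≤ n → 2 ≤ m n) (hK0 : 0 ≤ K) (hK : TailBound m ϱ₀ t K) {L : ℕ} (hL : 0 < L)
    (h₀ : ∀ a, (ϱ₀ a).length = L) (k d : ℕ) :
    ∃ C : ℝ, 0 ≤ C ∧ ∀ (P : Measure (ℤ → A)) [IsProbabilityMeasure P], ∀ N : ℕ, 0 < N →
      Close N (ENNReal.ofReal ((Real.exp (K * (2 : ℝ)⁻¹ ^ k) - 1) * Real.exp K + C / N))
        (P.map (extend (cascade m ϱ₀ t k) ∘ toLevel m k))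
        (P.map (extend (cascade m ϱ₀ t (k + d)) ∘ toLevel m (k + d))) := by
  cases nonempty_fintype A
  obtain ⟨R, hR, hsp⟩ := hK.spell_add_level hm hK0 k d
  set E : ℝ := Real.exp (K * (2 : ℝ)⁻¹ ^ k) with hE
  have hE1 : 1 ≤ E := Real.one_le_exp (by positivity)
  let c₀ : ℕ := blockLength m k * L
  have hc₀ : 0 < c₀ := Nat.mul_pos (blockLength_pos hm k) hL
  have hne := cascade_ne_nil (t := t) hm hL h₀
  refine ⟨(E - 1) * Real.exp K * (R * c₀), by
    have := sub_nonneg.2 hE1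
    positivity, fun P _ N hN => ?_⟩
  let G : (n : ℕ) → (ℤ → A) → Fin N → B := fun n =>
    firstWord N ∘ (extend (cascade m ϱ₀ t n) ∘ toLevel m n)
  have hEx : ∀ n, Measurable (extend (cascade m ϱ₀ t n) ∘ toLevel m n) := fun n =>
    (measurable_extend _).comp (measurable_toLevel n)
  have hG : ∀ n, Measurable (G n) := fun n => (measurable_firstWord N).comp (hEx n)
  -- Both words are coded from the same sequence `x`, so the edit distance can be bounded pointwise.
  refine ⟨P.map fun x => (G k x, G (k + d) x), ⟨?_, ?_⟩, ?_⟩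
  · rw [wordLaw, Measure.map_map measurable_fst ((hG _).prodMk (hG _)),
      Measure.map_map (measurable_firstWord N) (hEx k)]
    rfl
  · rw [wordLaw, Measure.map_map measurable_snd ((hG _).prodMk (hG _)),
      Measure.map_map (measurable_firstWord N) (hEx (k + d))]
    rfl
  · rw [lintegral_map Measurable.of_discrete ((hG _).prodMk (hG _))]
    refine (lintegral_mono (g := fun _ => _) fun x => ?_).trans
      (lintegral_const _ |>.trans_le (by rw [measure_univ, mul_one]))
    refine ENNReal.ofReal_le_ofReal ?_
    -- Enough letters of level `k + d` for even the shorter, tail-free spelling `W` to reach length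
    -- `N`, with an overshoot of at most `R * c₀` before the factor `exp K`.
    let S : ℕ := N / (R * c₀) + 1
    obtain ⟨h1, h2⟩ := hsp x S
    set W := spell (cascade m ϱ₀ t k) (toLevel m k x) (S * R) with hW
    set W' := spell (cascade m ϱ₀ t (k + d)) (toLevel m (k + d) x) S with hW'
    have hNW : N ≤ W.length := by
      refine le_trans ?_ (mul_le_length_spell (le_length_cascade (t := t) h₀ k) _ _)
      rw [mul_assoc]
      have h3 := Nat.div_add_mod N (R * c₀)
      have h4 := Nat.mod_lt N (Nat.mul_pos hR hc₀)
      have h5 : S * (R * c₀) = R * c₀ * (N / (R * c₀)) + R * c₀ := by simp only [S]; ring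
      change N ≤ S * (R * c₀)
      omega
    have hWle : (W.length : ℝ) ≤ Real.exp K * (N + R * c₀) := by
      have h3 : (W.length : ℝ) ≤ (S * R : ℕ) * (Real.exp K * c₀) := by
        rw [hW, length_spell, Nat.cast_sum]
        refine (Finset.sum_le_card_nsmul _ _ (Real.exp K * c₀) fun i _ => ?_).trans (by simp)
        refine (hK.length_cascade_le hK0 h₀ k _).trans (le_of_eq ?_)
        simp only [c₀]
        push_cast
        ring
      have hRc : (0 : ℝ) < ((R * c₀ : ℕ) : ℝ) := by exact_mod_cast Nat.mul_pos hR hc₀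
      have h4 : (S : ℝ) ≤ N / ((R * c₀ : ℕ) : ℝ) + 1 := by
        simp only [S]
        rw [Nat.cast_add, Nat.cast_one]
        gcongr
        exact Nat.cast_div_le
      have h5 : (S : ℝ) * ((R * c₀ : ℕ) : ℝ) ≤ N + (R * c₀ : ℕ) := by
        refine (mul_le_mul_of_nonneg_right h4 hRc.le).trans (le_of_eq ?_)
        field_simp
      push_cast at h3 h5
      nlinarith [Real.exp_pos K]
    have hlen := h1.length_le
    have hW'le : (W'.length : ℝ) ≤ E * W.length := by
      have : (0 : ℝ) < (2 : ℝ)⁻¹ ^ (k + d) := by positivity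
      exact h2.trans (mul_le_mul_of_nonneg_right
        (Real.exp_le_exp.2 (mul_le_mul_of_nonneg_left (by linarith) hK0)) (Nat.cast_nonneg _))
    -- `W` itself is the common sublist. What is missing is the total length of the tails, at most
    -- `(E - 1) |W|`.
    have h6 := editDist_le_of_sublist (r := W'.length - W.length) hN
      (ofFn_firstWord_extend (hne k) (toLevel m k x) hNW)
      (ofFn_firstWord_extend (hne (k + d)) (toLevel m (k + d) x) (hNW.trans hlen))
      (List.Sublist.refl W) h1
      (show W.length ≤ W.length + (W'.length - W.length) by omega)
      (show W'.length ≤ W.length + (W'.length - W.length) by omega)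
    refine h6.trans ?_
    rw [Nat.cast_sub hlen]
    have hN' : (0 : ℝ) < N := by exact_mod_cast hN
    rw [div_le_iff₀ hN', add_mul, div_mul_cancel₀ _ hN'.ne']
    nlinarith [mul_le_mul_of_nonneg_left hWle (sub_nonneg.2 hE1)]

end Levels

/-! ### Bernoulli measures on the levels -/

section LevelLaw

/-- Cutting into blocks is reindexing `ℤ` by quotient and remainder modulo `r`, followed by
currying; both preserve product measures. -/
theorem map_blocks_infinitePi {C : Type*} [MeasurableSpace C] (μ : Measure C)
    [IsProbabilityMeasure μ] {r : ℕ} (hr : r ≠ 0) :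
    (Measure.infinitePi fun _ : ℤ => μ).map (blocks r) =
      Measure.infinitePi fun _ : ℤ => Measure.pi fun _ : Fin r => μ := by
  have : NeZero r := ⟨hr⟩
  have h1 := Measure.infinitePi_map_piCongrLeft (fun _ : ℤ × Fin r => μ) (Int.divModEquiv r)
  have h2 := Measure.infinitePi_map_curry (fun (_ : ℤ) (_ : Fin r) => μ)
  simp only [Measure.infinitePi_eq_pi] at h2
  rw [← h2, ← h1, Measure.map_map (MeasurableEquiv.measurable _) (MeasurableEquiv.measurable _)]
  congr 1
  funext x i j
  have h3 : (MeasurableEquiv.piCongrLeft (fun _ : ℤ × Fin r => C) (Int.divModEquiv r)) x (i, j) =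
      x ((Int.divModEquiv r).symm (i, j)) := by
    have := MeasurableEquiv.piCongrLeft_apply_apply (β := fun _ : ℤ × Fin r => C)
      (Int.divModEquiv r) x ((Int.divModEquiv r).symm (i, j))
    rwa [Equiv.apply_symm_apply] at this
  change x (i * (r : ℤ) + (j : ℕ)) = MeasurableEquiv.piCongrLeft (fun _ : ℤ × Fin r => C)
    (Int.divModEquiv r) x (i, j)
  rw [h3]
  simp [Int.divModEquiv]

variable {A : Type*} [MeasurableSpace A] {m : ℕ → ℕ}

/-- The law of a letter of `A_n` composed of independent letters of `A` with law `μ`. -/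
noncomputable def levelLaw (m : ℕ → ℕ) (μ : Measure A) : (n : ℕ) → Measure (Level A m n)
  | 0 => μ
  | n + 1 => Measure.pi fun _ : Fin (m (n + 1)) => levelLaw m μ n

instance isProbabilityMeasure_levelLaw (μ : Measure A) [IsProbabilityMeasure μ] :
    (n : ℕ) → IsProbabilityMeasure (levelLaw m μ n)
  | 0 => inferInstanceAs (IsProbabilityMeasure μ)
  | n + 1 =>
      haveI := isProbabilityMeasure_levelLaw μ n
      inferInstanceAs (IsProbabilityMeasure (Measure.pi fun _ : Fin (m (n + 1)) => levelLaw m μ n))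

theorem levelMeasure_infinitePi (hm : ∀ n, 1 ≤ n → 2 ≤ m n) (μ : Measure A)
    [IsProbabilityMeasure μ] (n : ℕ) :
    levelMeasure m (Measure.infinitePi fun _ : ℤ => μ) n =
      Measure.infinitePi fun _ : ℤ => levelLaw m μ n := by
  induction n with
  | zero => exact Measure.map_id
  | succ n ih =>
    have h := hm (n + 1) (by omega)
    refine Eq.trans ?_ (map_blocks_infinitePi (levelLaw m μ n) (r := m (n + 1)) (by omega))
    rw [← ih]
    exact (Measure.map_map (measurable_blocks _) (measurable_toLevel n)).symm

theorem infinitePi_letterCylinder (μ : Measure A) [IsProbabilityMeasure μ]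
    [DiscreteMeasurableSpace A] (a : A) :
    (Measure.infinitePi fun _ : ℤ => μ).real (letterCylinder a) = μ.real {a} := by
  have h := Measure.infinitePi_map_eval (fun _ : ℤ => μ) 0
  conv_rhs => rw [← h]
  rw [map_measureReal_apply (measurable_pi_apply _) (MeasurableSet.singleton a)]
  rfl

end LevelLaw

/-! ### Concentration of the lengths of the words -/

section Concentration

open ProbabilityTheory

/-- Centring at the mean of `X` alone can only increase the second moment, and `(u + y)² ≤ 3/2 u² +
3 y²` is `(u - 2y)² ≥ 0`. The factor `3/2` is below `2`, so halving the relative variance at each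
level still leaves a contraction. -/
theorem variance_add_le {Ω : Type*} [Finite Ω] [MeasurableSpace Ω] [DiscreteMeasurableSpace Ω]
    (μ : Measure Ω) [IsProbabilityMeasure μ] (X Y : Ω → ℝ) {c : ℝ} (hY : ∀ ω, |Y ω| ≤ c) :
    variance (X + Y) μ ≤ 3 / 2 * variance X μ + 3 * c ^ 2 := by
  have hi : ∀ f : Ω → ℝ, Integrable f μ := fun f => Integrable.of_finite
  have e : variance (X + Y) μ = variance (fun ω => (X + Y) ω - ∫ ω, X ω ∂μ) μ :=
    (variance_sub_const (Measurable.of_discrete).aestronglyMeasurable _).symm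
  rw [e]
  refine (variance_le_expectation_sq (Measurable.of_discrete).aestronglyMeasurable).trans ?_
  rw [variance_eq_integral (Measurable.of_discrete).aemeasurable, ← integral_const_mul]
  have h : 3 * c ^ 2 = ∫ _, 3 * c ^ 2 ∂μ := by simp
  rw [h, ← integral_add (hi _) (hi _)]
  refine integral_mono (hi _) (hi _) fun ω => ?_
  have h1 : Y ω ^ 2 ≤ c ^ 2 := sq_le_sq' (by linarith [abs_le.1 (hY ω)]) (abs_le.1 (hY ω)).2
  simp only [Pi.pow_apply, Pi.add_apply]
  nlinarith [sq_nonneg (X ω - ∫ ω, X ω ∂μ - 2 * Y ω)]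

theorem variance_sum_add_le {C : Type*} [Finite C] [MeasurableSpace C] [DiscreteMeasurableSpace C]
    (μ : Measure C) [IsProbabilityMeasure μ] {r : ℕ} (X : C → ℝ) (Y : (Fin r → C) → ℝ) {c : ℝ}
    (hY : ∀ ω, |Y ω| ≤ c) :
    variance (fun a : Fin r → C => ∑ i, X (a i) + Y a) (Measure.pi fun _ => μ) ≤
      3 / 2 * (r * variance X μ) + 3 * c ^ 2 := by
  have h := variance_sum_pi (ι := Fin r) (μ := fun _ => μ) (X := fun _ => X) fun _ =>
    MemLp.of_discrete
  simp only [Finset.sum_const, Finset.card_univ, Fintype.card_fin, nsmul_eq_mul] at h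
  rw [← h]
  refine le_trans (le_of_eq ?_) (variance_add_le (Measure.pi fun _ => μ) _ Y hY)
  congr 1
  ext a
  simp

variable {A B : Type*} [Fintype A] [MeasurableSpace A] [DiscreteMeasurableSpace A] {m : ℕ → ℕ}
  {ϱ₀ : A → List B} {t : (n : ℕ) → Level A m n → List B} {K : ℝ}

/-- In units of `(blockLength m n * L)²`, the variance bound obeys `v_{n+1} = 3/4 v_n + 3 H
(1/4)^(n+1)` with `H = (K exp K)²` and `v_0 = 0`. The right-hand side is the exact solution. -/
theorem TailBound.variance_length_le (hm : ∀ n, 1 ≤ n → 2 ≤ m n) (hK0 : 0 ≤ K)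
    (hK : TailBound m ϱ₀ t K) {L : ℕ} (h₀ : ∀ a, (ϱ₀ a).length = L) (μ : Measure A)
    [IsProbabilityMeasure μ] (n : ℕ) :
    variance (fun a => ((cascade m ϱ₀ t n a).length : ℝ)) (levelLaw m μ n) ≤
      3 / 2 * (K * Real.exp K) ^ 2 * ((3 / 4) ^ n - (1 / 4) ^ n) * (blockLength m n * L) ^ 2 := by
  induction n with
  | zero =>
    have : (fun a => ((cascade m ϱ₀ t 0 a).length : ℝ)) = fun _ => (L : ℝ) := by
      funext a
      exact congrArg _ (h₀ a)
    rw [this]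
    rw [variance_eq_integral measurable_const.aemeasurable]
    simp
  | succ n ih =>
    have hY : ∀ a : Fin (m (n + 1)) → Level A m n, |((t (n + 1) a).length : ℝ)| ≤
        K * (2 : ℝ)⁻¹ ^ (n + 1) * (m (n + 1) * (Real.exp K * (blockLength m n * L))) := by
      intro a
      rw [abs_of_nonneg (Nat.cast_nonneg _)]
      refine (hK n a).trans (mul_le_mul_of_nonneg_left ?_ (by positivity))
      refine (Finset.sum_le_card_nsmul _ _ _ fun i _ =>
        hK.length_cascade_le hK0 h₀ n (a i)).trans (by simp)
    have e : (fun a : Level A m (n + 1) => ((cascade m ϱ₀ t (n + 1) a).length : ℝ)) =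
        fun a : Fin (m (n + 1)) → Level A m n =>
          ∑ i, ((cascade m ϱ₀ t n (a i)).length : ℝ) + ((t (n + 1) a).length : ℝ) := by
      funext a
      rw [length_cascade_succ]
      push_cast
      rfl
    rw [e]
    refine (variance_sum_add_le (levelLaw m μ n)
      (fun a => ((cascade m ϱ₀ t n a).length : ℝ)) _ hY).trans ?_
    have hm2 : (2 : ℝ) ≤ m (n + 1) := by exact_mod_cast hm (n + 1) (by omega)
    rw [blockLength_succ]
    push_cast
    set M : ℝ := blockLength m n * L with hM
    set r : ℝ := (m (n + 1) : ℝ)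
    set H : ℝ := (K * Real.exp K) ^ 2
    have hH : 0 ≤ H := sq_nonneg _
    have hq : (0 : ℝ) ≤ (3 / 4) ^ n - (1 / 4) ^ n :=
      sub_nonneg.2 (pow_le_pow_left₀ (by norm_num) (by norm_num) n)
    -- Here `m_n ≥ 2` enters: the variance of the independent sum grows by `r`, the squared length
    -- by `r²`, so the relative variance is at least halved before the tail is added.
    have hr2 : r ≤ r ^ 2 / 2 := by nlinarith
    have e2 : ((2 : ℝ)⁻¹ ^ (n + 1)) ^ 2 = (1 / 4) ^ (n + 1) := by
      rw [← pow_mul, mul_comm, pow_mul]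
      norm_num
    have e3 : 3 * (K * (2 : ℝ)⁻¹ ^ (n + 1) * (r * (Real.exp K * M))) ^ 2 =
        3 * H * (1 / 4) ^ (n + 1) * (r * M) ^ 2 := by
      rw [← e2]
      ring
    have h1 : 3 / 2 * (r * variance (fun a => ((cascade m ϱ₀ t n a).length : ℝ)) (levelLaw m μ n))
        ≤ 3 / 2 * (r ^ 2 / 2 * (3 / 2 * H * ((3 / 4) ^ n - (1 / 4) ^ n) * M ^ 2)) := by
      have : r * variance (fun a => ((cascade m ϱ₀ t n a).length : ℝ)) (levelLaw m μ n) ≤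
          r ^ 2 / 2 * (3 / 2 * H * ((3 / 4) ^ n - (1 / 4) ^ n) * M ^ 2) :=
        mul_le_mul hr2 ih (variance_nonneg _ _) (by positivity)
      linarith
    rw [e3]
    refine (add_le_add_left h1 _).trans (le_of_sub_nonneg ?_)
    rw [mul_assoc r, ← hM]
    have e4 : 3 / 2 * H * ((3 / 4) ^ (n + 1) - (1 / 4) ^ (n + 1)) * (r * M) ^ 2 -
        (3 / 2 * (r ^ 2 / 2 * (3 / 2 * H * ((3 / 4) ^ n - (1 / 4) ^ n) * M ^ 2)) +
          3 * H * (1 / 4) ^ (n + 1) * (r * M) ^ 2) = 0 := by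
      rw [pow_succ, pow_succ]
      ring
    exact e4.ge

end Concentration

/-! ### Length-weighted probability vectors -/

section Tilde

open ProbabilityTheory

variable {C B : Type*} [Fintype C] [MeasurableSpace C] [DiscreteMeasurableSpace C]

theorem measureReal_singleton_mem_stdSimplex (μ : Measure C) [IsProbabilityMeasure μ] :
    (fun a => μ.real {a}) ∈ stdSimplex ℝ C :=
  ⟨fun _ => measureReal_nonneg, by
    rw [sum_measureReal_singleton]
    simp⟩

theorem letterLaw_measureReal_singleton (μ : Measure C) [IsProbabilityMeasure μ] :
    letterLaw (fun a => μ.real {a}) = μ :=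
  Measure.ext_of_singleton fun a => by
    rw [letterLaw_singleton, ofReal_measureReal]

theorem tildeVec_infinitePi (ϱ : C → List B) (μ : Measure C) [IsProbabilityMeasure μ] (a : C) :
    tildeVec ϱ (Measure.infinitePi fun _ : ℤ => μ) a =
      ((ϱ a).length * μ.real {a}) / ∫ b, ((ϱ b).length : ℝ) ∂μ := by
  rw [integral_fintype Integrable.of_finite]
  simp only [tildeVec, infinitePi_letterCylinder, smul_eq_mul, mul_comm]

theorem le_integral_length {ϱ : C → List B} {c₀ : ℕ} (h₀ : ∀ a, c₀ ≤ (ϱ a).length)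
    (μ : Measure C) [IsProbabilityMeasure μ] : (c₀ : ℝ) ≤ ∫ b, ((ϱ b).length : ℝ) ∂μ := by
  have : (c₀ : ℝ) = ∫ _, (c₀ : ℝ) ∂μ := by simp
  rw [this]
  exact integral_mono Integrable.of_finite Integrable.of_finite fun a => Nat.cast_le.2 (h₀ a)

theorem tildeVec_mem_stdSimplex {ϱ : C → List B} {c₀ : ℕ} (hc₀ : 0 < c₀)
    (h₀ : ∀ a, c₀ ≤ (ϱ a).length) (μ : Measure C) [IsProbabilityMeasure μ] :
    tildeVec ϱ (Measure.infinitePi fun _ : ℤ => μ) ∈ stdSimplex ℝ C := by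
  have h1 : (0 : ℝ) < ∫ b, ((ϱ b).length : ℝ) ∂μ :=
    lt_of_lt_of_le (by exact_mod_cast hc₀) (le_integral_length h₀ μ)
  constructor
  · intro a
    rw [tildeVec_infinitePi]
    have := measureReal_nonneg (μ := μ) (s := {a})
    positivity
  · simp only [tildeVec_infinitePi]
    rw [← Finset.sum_div, div_eq_one_iff_eq h1.ne', integral_fintype Integrable.of_finite]
    simp only [smul_eq_mul, mul_comm]

/-- With `e` the mean length, the weighted vector has density `|ϱ(a)| / e` with respect to `μ`, so
the sum is `E| |ϱ| - e | / e`. Cauchy–Schwarz and `e ≥ c₀` bound it by the standard deviation over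
`c₀`. -/
theorem sum_abs_tildeVec_sub_le {ϱ : C → List B} {c₀ : ℕ} (hc₀ : 0 < c₀)
    (h₀ : ∀ a, c₀ ≤ (ϱ a).length) (μ : Measure C) [IsProbabilityMeasure μ] {v : ℝ}
    (hv : variance (fun a => ((ϱ a).length : ℝ)) μ ≤ v * c₀ ^ 2) :
    ∑ a, |tildeVec ϱ (Measure.infinitePi fun _ : ℤ => μ) a - μ.real {a}| ≤ √v := by
  set e : ℝ := ∫ b, ((ϱ b).length : ℝ) ∂μ with he
  have hc : (0 : ℝ) < c₀ := by exact_mod_cast hc₀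
  have h1 : (c₀ : ℝ) ≤ e := le_integral_length h₀ μ
  have h2 : (0 : ℝ) < e := hc.trans_le h1
  set f : C → ℝ := fun a => |((ϱ a).length : ℝ) - e| with hf
  have h3 : ∑ a, |tildeVec ϱ (Measure.infinitePi fun _ : ℤ => μ) a - μ.real {a}| =
      (∫ a, f a ∂μ) / e := by
    rw [integral_fintype Integrable.of_finite, Finset.sum_div]
    refine Finset.sum_congr rfl fun a _ => ?_
    have : tildeVec ϱ (Measure.infinitePi fun _ : ℤ => μ) a - μ.real {a} =
        μ.real {a} * (((ϱ a).length : ℝ) - e) / e := by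
      rw [tildeVec_infinitePi, ← he]
      field_simp
    rw [this, abs_div, abs_mul, abs_of_pos h2, abs_of_nonneg measureReal_nonneg, smul_eq_mul]
  have h4 : (∫ a, f a ∂μ) ^ 2 ≤ v * c₀ ^ 2 := by
    refine le_trans ?_ hv
    -- Cauchy–Schwarz, in the form that the variance of the absolute deviation is nonnegative.
    have h5 := variance_nonneg f μ
    rw [variance_eq_sub MemLp.of_discrete] at h5
    rw [variance_eq_integral (Measurable.of_discrete).aemeasurable]
    refine (sub_nonneg.1 h5).trans (le_of_eq ?_)
    congr 1
    ext a
    simp [hf, sq_abs, he]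
  have hv0 : 0 ≤ v := by
    by_contra h
    have : v * c₀ ^ 2 < 0 := mul_neg_of_neg_of_pos (not_le.1 h) (by positivity)
    nlinarith [sq_nonneg (∫ a, f a ∂μ)]
  rw [h3, div_le_iff₀ h2]
  refine (Real.le_sqrt_of_sq_le h4).trans ?_
  rw [Real.sqrt_mul hv0, Real.sqrt_sq hc.le]
  gcongr

end Tilde

/-! ### The sequence of Bernoulli-coded measures -/

section Main

variable {A B : Type*} [Fintype A] [Nonempty A] [MeasurableSpace A] [DiscreteMeasurableSpace A]
  [Nonempty B] [MeasurableSpace B]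
  {m : ℕ → ℕ} {ϱ₀ : A → List B} {t : (n : ℕ) → Level A m n → List B} {K : ℝ}

theorem isProbabilityMeasure_nu (hm : ∀ n, 1 ≤ n → 2 ≤ m n) {L : ℕ} (hL : 0 < L)
    (h₀ : ∀ a, (ϱ₀ a).length = L) (μ : Measure A) [IsProbabilityMeasure μ] (n : ℕ) :
    IsProbabilityMeasure (nu m ϱ₀ t n (Measure.infinitePi fun _ : ℤ => μ)) := by
  rw [nu, levelMeasure_infinitePi hm]
  have := isProbabilityMeasure_letterLaw (tildeVec_mem_stdSimplex
    (Nat.mul_pos (blockLength_pos hm n) hL) (le_length_cascade (t := t) h₀ n) (levelLaw m μ n))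
  have : IsProbabilityMeasure (bernoulli (tildeVec (cascade m ϱ₀ t n)
      (Measure.infinitePi fun _ : ℤ => levelLaw m μ n))) := by
    unfold bernoulli
    infer_instance
  exact isProbabilityMeasure_kappaInv (cascade_ne_nil hm hL h₀ n) _

variable [Finite B] [DiscreteMeasurableSpace B]

theorem TailBound.close_nu_map (hm : ∀ n, 1 ≤ n → 2 ≤ m n) (hK0 : 0 ≤ K)
    (hK : TailBound m ϱ₀ t K) {L : ℕ} (hL : 0 < L) (h₀ : ∀ a, (ϱ₀ a).length = L)
    (μ : Measure A) [IsProbabilityMeasure μ] (n : ℕ) :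
    ∃ C : ℝ, 0 ≤ C ∧ ∀ N : ℕ, 0 < N → Close N
      (ENNReal.ofReal (Real.exp K *
        √(3 / 2 * (K * Real.exp K) ^ 2 * ((3 / 4) ^ n - (1 / 4) ^ n)) + C / N))
      (nu m ϱ₀ t n (Measure.infinitePi fun _ : ℤ => μ))
      ((Measure.infinitePi fun _ : ℤ => μ).map (extend (cascade m ϱ₀ t n) ∘ toLevel m n)) := by
  let c₀ : ℕ := blockLength m n * L
  have hc₀ : 0 < c₀ := Nat.mul_pos (blockLength_pos hm n) hL
  have hlow : ∀ a, c₀ ≤ (cascade m ϱ₀ t n a).length := le_length_cascade h₀ n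
  have hup : ∀ a, (cascade m ϱ₀ t n a).length ≤ ⌊Real.exp K * c₀⌋₊ := fun a => by
    refine Nat.le_floor ((hK.length_cascade_le hK0 h₀ n a).trans (le_of_eq ?_))
    simp only [c₀, Nat.cast_mul]
  have hvar := hK.variance_length_le hm hK0 h₀ μ n
  have hτ := sum_abs_tildeVec_sub_le hc₀ hlow (levelLaw m μ n)
    (v := 3 / 2 * (K * Real.exp K) ^ 2 * ((3 / 4) ^ n - (1 / 4) ^ n))
    (by simpa only [c₀, Nat.cast_mul] using hvar)
  obtain ⟨C, hC, h⟩ := close_kappaInv_bernoulli hc₀ hlow hup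
    (tildeVec_mem_stdSimplex hc₀ hlow (levelLaw m μ n))
    (measureReal_singleton_mem_stdSimplex (levelLaw m μ n)) hτ
  refine ⟨C, hC, fun N hN => ?_⟩
  have e : (Measure.infinitePi fun _ : ℤ => μ).map (extend (cascade m ϱ₀ t n) ∘ toLevel m n) =
      (bernoulli fun a => (levelLaw m μ n).real {a}).map (extend (cascade m ϱ₀ t n)) := by
    rw [bernoulli, letterLaw_measureReal_singleton, ← levelMeasure_infinitePi hm, levelMeasure,
      Measure.map_map (measurable_extend _) (measurable_toLevel n)]
  rw [e, nu, levelMeasure_infinitePi hm]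
  obtain ⟨γ, hγ, hle⟩ := h N hN
  refine ⟨γ, hγ, hle.trans (ENNReal.ofReal_le_ofReal ?_)⟩
  gcongr
  rw [div_le_iff₀ (by exact_mod_cast hc₀)]
  exact Nat.floor_le (by positivity)

theorem TailBound.eventually_close_nu (hm : ∀ n, 1 ≤ n → 2 ≤ m n) (hK0 : 0 ≤ K)
    (hK : TailBound m ϱ₀ t K) {L : ℕ} (hL : 0 < L) (h₀ : ∀ a, (ϱ₀ a).length = L) {ε : ℝ}
    (hε : 0 < ε) :
    ∃ n₀ : ℕ, ∀ k d : ℕ, n₀ ≤ k → ∀ (μ : Measure A) [IsProbabilityMeasure μ], ∀ᶠ N in atTop,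
      Close N (ENNReal.ofReal ε) (nu m ϱ₀ t k (Measure.infinitePi fun _ : ℤ => μ))
        (nu m ϱ₀ t (k + d) (Measure.infinitePi fun _ : ℤ => μ)) := by
  set δ : ℕ → ℝ := fun n =>
    Real.exp K * √(3 / 2 * (K * Real.exp K) ^ 2 * ((3 / 4) ^ n - (1 / 4) ^ n)) with hδ
  set η : ℕ → ℝ := fun n => (Real.exp (K * (2 : ℝ)⁻¹ ^ n) - 1) * Real.exp K with hη
  have hδ0 : Tendsto δ atTop (nhds 0) := by
    have h1 := tendsto_pow_atTop_nhds_zero_of_lt_one (r := (3 / 4 : ℝ)) (by norm_num) (by norm_num)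
    have h2 := tendsto_pow_atTop_nhds_zero_of_lt_one (r := (1 / 4 : ℝ)) (by norm_num) (by norm_num)
    have h3 := (((h1.sub h2).const_mul (3 / 2 * (K * Real.exp K) ^ 2)).sqrt).const_mul (Real.exp K)
    simpa [hδ] using h3
  have hη0 : Tendsto η atTop (nhds 0) := by
    have h1 := tendsto_pow_atTop_nhds_zero_of_lt_one (r := (2 : ℝ)⁻¹) (by norm_num) (by norm_num)
    have h2 := (((Real.continuous_exp.tendsto _).comp (h1.const_mul K)).sub_const 1).mul_const
      (Real.exp K)
    simpa [hη] using h2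
  -- Six errors are added: `δ` at both levels, `η` once, and three terms `C / N`.
  have hε6 : 0 < ε / 6 := by positivity
  obtain ⟨n₀, hn₀⟩ := eventually_atTop.1
    ((hδ0.eventually_lt_const hε6).and (hη0.eventually_lt_const hε6))
  refine ⟨n₀, fun k d hk μ _ => ?_⟩
  set P : Measure (ℤ → A) := Measure.infinitePi fun _ : ℤ => μ
  -- These constants may depend on `μ`, `k` and `d`. They affect only how large `N` must be, since
  -- `n₀` is already fixed.
  obtain ⟨C₁, hC₁, h₁⟩ := hK.close_nu_map hm hK0 hL h₀ μ k
  obtain ⟨C₂, hC₂, h₂⟩ := hK.close_map_extend hm hK0 hL h₀ k d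
  obtain ⟨C₃, hC₃, h₃⟩ := hK.close_nu_map hm hK0 hL h₀ μ (k + d)
  have hN : ∀ C : ℝ, ∀ᶠ N : ℕ in atTop, C / N < ε / 6 := fun C =>
    (tendsto_const_div_atTop_nhds_zero_nat C).eventually_lt_const hε6
  have hp := isProbabilityMeasure_nu (t := t) hm hL h₀ μ
  have hq : ∀ n, IsProbabilityMeasure (P.map (extend (cascade m ϱ₀ t n) ∘ toLevel m n)) :=
    fun n => Measure.isProbabilityMeasure_map
      ((measurable_extend _).comp (measurable_toLevel n)).aemeasurable
  filter_upwards [hN C₁, hN C₂, hN C₃, eventually_gt_atTop 0] with N n₁ n₂ n₃ hN0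
  obtain ⟨γ, hγ, hle⟩ := ((h₁ N hN0).trans (h₂ P N hN0)).trans (h₃ N hN0).symm
  refine ⟨γ, hγ, hle.trans ?_⟩
  have d₁ := (hn₀ k hk).1
  have d₂ := (hn₀ k hk).2
  have d₃ := (hn₀ (k + d) (by omega)).1
  have hη1 : 0 ≤ η k := mul_nonneg (sub_nonneg.2 (Real.one_le_exp (by positivity)))
    (Real.exp_pos K).le
  change ENNReal.ofReal (δ k + C₁ / N) + ENNReal.ofReal (η k + C₂ / N) +
    ENNReal.ofReal (δ (k + d) + C₃ / N) ≤ _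
  rw [← ENNReal.ofReal_add (by positivity) (by positivity),
    ← ENNReal.ofReal_add (by positivity) (by positivity)]
  exact ENNReal.ofReal_le_ofReal (by linarith)

end Main

end BernoulliCoded

theorem theorem4 {A : Type*} {B : Type*}
    [Fintype A] [Nonempty A] [MeasurableSpace A] [DiscreteMeasurableSpace A]
    [Fintype B] [Nonempty B] [MeasurableSpace B] [DiscreteMeasurableSpace B]
    (m : ℕ → ℕ) (hm : ∀ n, 1 ≤ n → 2 ≤ m n)
    (ϱ₀ : A → List B) (hϱ₀ : ∀ a, ϱ₀ a ≠ [])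
    (t : (n : ℕ) → BernoulliCoded.Level A m n → List B)
    (hT : BernoulliCoded.TailControl m ϱ₀ t) :
    (∀ n, ∀ P ∈ BernoulliCoded.bernoulliMeasures A,
      MeasureTheory.IsProbabilityMeasure (BernoulliCoded.nu m ϱ₀ t n P)) ∧
    ∀ ε : ℝ, 0 < ε → ∃ n₀ : ℕ, 1 ≤ n₀ ∧ ∀ k l : ℕ, n₀ ≤ k → n₀ ≤ l →
      ∀ P ∈ BernoulliCoded.bernoulliMeasures A,
        BernoulliCoded.fbar (BernoulliCoded.nu m ϱ₀ t k P) (BernoulliCoded.nu m ϱ₀ t l P) < ε := by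
  obtain ⟨hconst, K, hK0, hK⟩ := hT
  obtain ⟨L, hL⟩ : ∃ L, ∀ a, (ϱ₀ a).length = L :=
    ⟨(ϱ₀ (Classical.arbitrary A)).length, fun a => hconst _ _⟩
  have hLpos : 0 < L := by
    rw [← hL (Classical.arbitrary A)]
    exact List.length_pos_iff.2 (hϱ₀ _)
  refine ⟨?_, fun ε hε => ?_⟩
  · rintro n _ ⟨p, hp, rfl⟩
    have := BernoulliCoded.isProbabilityMeasure_letterLaw hp
    exact BernoulliCoded.isProbabilityMeasure_nu hm hLpos hL (BernoulliCoded.letterLaw p) n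
  -- `ε / 2` makes the final inequality strict.
  · obtain ⟨n₀, hn₀⟩ := BernoulliCoded.TailBound.eventually_close_nu hm hK0.le hK hLpos hL
      (half_pos hε)
    refine ⟨n₀ + 1, by omega, ?_⟩
    rintro k l hk hl _ ⟨p, hp, rfl⟩
    have := BernoulliCoded.isProbabilityMeasure_letterLaw hp
    have key : ∀ᶠ N in Filter.atTop, BernoulliCoded.Close N (ENNReal.ofReal (ε / 2))
        (BernoulliCoded.nu m ϱ₀ t k (BernoulliCoded.bernoulli p))
        (BernoulliCoded.nu m ϱ₀ t l (BernoulliCoded.bernoulli p)) := by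
      rcases le_total k l with h | h
      · obtain ⟨d, rfl⟩ := Nat.exists_eq_add_of_le h
        exact hn₀ k d (by omega) (BernoulliCoded.letterLaw p)
      · obtain ⟨d, rfl⟩ := Nat.exists_eq_add_of_le h
        exact (hn₀ l d (by omega) (BernoulliCoded.letterLaw p)).mono fun N hN => hN.symm
    refine lt_of_le_of_lt (BernoulliCoded.fbar_le_of_frequently ?_) (half_lt_self hε)
    exact (key.mono fun N hN => hN.fbarN_le (half_pos hε).le).frequently
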